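/- Let $\mathbb F_q$ be the finite field with $q$ elements and $\overline{\mathbb F}_q$ an algebraic closure; all fields $\mathbb F_{q^t}$ are taken inside it. For $a\in\overline{\mathbb F}_q^{\,*}$ let $\mathrm{ord}(a)$ be its multiplicative order. For an irreducible $g\in\mathbb F_q[X]$, $g\ne X$, let $\mathrm{ord}(g)$ be the least $e\ge 1$ with $g\mid X^e-1$. Let $\mathrm{rad}(n)$ be the product of the primes dividing $n$, and $\mathrm{ord}_m(u)$ the multiplicative order of $u$ modulo $m$. For $h=\sum_i a_iX^i\in\overline{\mathbb F}_q[X]$, the degree of the coefficients of $h$ is $\delta(h)=[\mathbb F_q(a_0,a_1,\ldots):\mathbb F_q]$, and the $q$-spin of $h$ is $\prod_{u=0}^{\delta(h)-1}\sum_i a_i^{q^u}X^i$. Let $f\in\mathbb F_q[X]$, $f\neq X$, be monic and irreducible of degree $k$, and let $\alpha\in\mathbb F_{q^k}^*$ be a root of $f$. Let $n$ be a positive integer with $\gcd(n,q)=1$, and write $n=n_1n_2$ with $\mathrm{rad}(n_1)\mid\mathrm{ord}(\alpha)$ and $\gcd(n_2,\mathrm{ord}(\alpha))=1$. Let $w=\mathrm{ord}_{\mathrm{rad}(n)}(q^k)$,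 and let $s=w$ if $4\nmid n$ or $q^{kw}\equiv1\pmod 4$, and $s=2w$ otherwise. For $t\ge1$ put $$d_1^{(t)}=\gcd\Big(n_1,\frac{q^{kt}-1}{\mathrm{ord}(\alpha)}\Big),\qquad d_2^{(t)}=\gcd(n_2,q^{kt}-1).$$ Let $s_1=d_1^{(s)}/d_1^{(1)}$ if $4\nmid d_1^{(s)}$ or $q^k\equiv1\pmod4$, and $s_1=2d_1^{(s)}/d_1^{(2)}$ otherwise. For an integer $i\ge0$ let $t_i$ be the least $t\ge1$ such that $i$ is an integer multiple of the rational number $d_2^{(s)}/d_2^{(t)}$, and let $c_i=\mathrm{lcm}(t_i,s_1)$. Let $\zeta_1,\zeta_2\in\overline{\mathbb F}_q$ be primitive roots of unity of orders $d_1^{(s)}$ and $d_2^{(s)}$ respectively. Then there exists $\beta\in\mathbb F_{q^{ks}}$ with $\beta^{d_1^{(s)}}=\alpha$, and there exists a positive integer $r$ such that $r=1$ if $f=X-1$, and $rn_2\equiv1\pmod{\mathrm{ord}(\alpha)\,d_1^{(s)}}$ otherwise. For any such $\beta$ and $r$ the following holds. On $\{0,\ldots,d_1^{(s)}-1\}$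 an equivalence relation is given by: $j\sim\tilde j$ if and only if $\zeta_1^{\tilde j}=\zeta_1^{jq^{km}}\beta^{q^{km}-1}$ for some integer $0\le m\le s_1-1$. Let $J$ be any complete set of representatives of $\sim$, and $I$ any complete set of (nonnegative integer) representatives of the $q^k$-cyclotomic cosets $\{iq^{kl}\bmod d_2^{(s)}: l\ge0\}$ modulo $d_2^{(s)}$. Then the factorization of $f(X^n)$ into monic irreducible polynomials over $\mathbb F_q$ is $$f(X^n)=\prod_{j\in J}\ \prod_{v\mid n_2/d_2^{(s)}}\ \prod_{\substack{i\in I\\ \gcd(i,v)=1}}\ \prod_{m=0}^{\gcd(t_i,s_1)-1}S_{(j,v,i,m)},$$ where, with $x=x_{(j,v,i,m)}=\zeta_2^{\,i q^{km}}(\zeta_1^{\,j}\beta)^{rv}$, $$S_{(j,v,i,m)}=\sum_{l=0}^{kc_i}X^{\frac{n_1}{d_1^{(s)}}vl}\,(-1)^{kc_i-l}\sum_{\substack{U\subseteq\{0,\ldots,kc_i-1\}\\|U|=kc_i-l}}\ \prod_{u\in U}x^{q^u}.$$ Each $S_{(j,v,i,m)}$ lies in $\mathbb F_q[X]$, is monic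 and irreducible over $\mathbb F_q$, has degree $k\cdot\frac{n_1}{d_1^{(s)}}\cdot v\cdot c_i$ and order $\mathrm{ord}(\alpha)\cdot n_1\cdot v\cdot\frac{d_2^{(s)}}{\gcd(i,d_2^{(s)})}$, and is the $q$-spin of the binomial $X^{\frac{n_1}{d_1^{(s)}}v}-x$, whose degree of the coefficients over $\mathbb F_q$ is $kc_i$. -/

import Mathlib

namespace PowerComp

open Polynomial

/-- `h^{(j)}`: every coefficient of `h` is raised to the power `q ^ j`. -/
noncomputable def twist {E : Type*} [Field E] (q j : ℕ) (h : E[X]) : E[X] :=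
  h.sum fun i a => monomial i (a ^ q ^ j)

/-- The degree over `F` of the field generated over `F` by the coefficients of `h`. -/
noncomputable def coeffDeg (F : Type*) {E : Type*} [Field F] [Field E] [Algebra F E]
    (h : E[X]) : ℕ :=
  Module.finrank F (IntermediateField.adjoin F (h.coeffs : Set E))

/-- The `q`-spin of `h`, where `q` is the number of elements of `F`: the product of the
`h^{(j)}`, where `j` runs from `0` to the degree of the coefficients of `h` minus `1`. -/
noncomputable def spin (F : Type*) {E : Type*} [Field F] [Field E] [Algebra F E]
    (h : E[X]) : E[X] :=
  ∏ j ∈ Finset.range (coeffDeg F h), twist (Nat.card F) j h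

/-- The order of a polynomial `g`: the least positive `e` such that `g ∣ X ^ e - 1`. -/
noncomputable def polyOrder {F : Type*} [Field F] (g : F[X]) : ℕ :=
  sInf {e : ℕ | 0 < e ∧ g ∣ X ^ e - 1}

/-- The multiplicative order of `Q` modulo the radical of `n`. -/
noncomputable def baseExt (Q n : ℕ) : ℕ :=
  orderOf (Q : ZMod (UniqueFactorizationMonoid.radical n))

open Classical in
/-- `s = w` if `4 ∤ n` or `Q ^ w ≡ 1 (mod 4)`, and `s = 2 w` otherwise, with
`w = baseExt Q n`. -/
noncomputable def extDeg (Q n : ℕ) : ℕ :=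
  if ¬ 4 ∣ n ∨ Q ^ baseExt Q n ≡ 1 [MOD 4] then baseExt Q n else 2 * baseExt Q n

/-- `d₁^{(t)} = gcd (n₁, (Q ^ t - 1) / e)`. -/
def dOne (Q e n₁ t : ℕ) : ℕ := Nat.gcd n₁ ((Q ^ t - 1) / e)

/-- `d₂^{(t)} = gcd (n₂, Q ^ t - 1)`. -/
def dTwo (Q n₂ t : ℕ) : ℕ := Nat.gcd n₂ (Q ^ t - 1)

open Classical in
/-- The number `s₁`. -/
noncomputable def sOne (Q e n₁ s : ℕ) : ℕ :=
  if ¬ 4 ∣ dOne Q e n₁ s ∨ Q ≡ 1 [MOD 4] then dOne Q e n₁ s / dOne Q e n₁ 1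
  else 2 * dOne Q e n₁ s / dOne Q e n₁ 2

/-- The number `t_i`: the least positive `t` such that the quotient
`d₂^{(s)} / d₂^{(t)}` divides `i`. The divisibility is written without the quotient, since
`d₂^{(t)}` need not divide `d₂^{(s)}` when `t` does not divide `s`. -/
noncomputable def tNum (Q n₂ s i : ℕ) : ℕ :=
  sInf {t : ℕ | 0 < t ∧ dTwo Q n₂ s ∣ i * dTwo Q n₂ t}

/-- The number `c_i = lcm (t_i, s₁)`. -/
noncomputable def cNum (Q e n₁ n₂ s i : ℕ) : ℕ :=
  Nat.lcm (tNum Q n₂ s i) (sOne Q e n₁ s)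

/-- The relation `j ∼ j'`, given by `ζ ^ j' = ζ ^ (j Q ^ m) β ^ (Q ^ m - 1)` for some
`0 ≤ m ≤ s₁ - 1`. -/
def expRel {E : Type*} [Field E] (Q s₁ : ℕ) (ζ β : E) (j j' : ℕ) : Prop :=
  ∃ m < s₁, ζ ^ j' = ζ ^ (j * Q ^ m) * β ^ (Q ^ m - 1)

/-- `J` is a complete set of representatives of `{0, …, d - 1}` modulo the relation `r`. -/
def IsRepSystem (d : ℕ) (r : ℕ → ℕ → Prop) (J : Finset ℕ) : Prop :=
  (∀ j ∈ J, j < d) ∧ ∀ a < d, ∃! j, j ∈ J ∧ r j a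

/-- The `Q`-cyclotomic coset of `i` modulo `d`, as a set of residues in `{0, …, d - 1}`. -/
def cycloCoset (Q d i : ℕ) : Set ℕ := {a | ∃ l : ℕ, a = i * Q ^ l % d}

/-- `I` is a complete set of representatives of the `Q`-cyclotomic cosets modulo `d`. -/
def IsCycloRepSystem (Q d : ℕ) (I : Finset ℕ) : Prop :=
  ∀ a < d, ∃! i, i ∈ I ∧ a ∈ cycloCoset Q d i

/-- The polynomial
`∑_{l=0}^{N} X^{T l} (-1)^{N-l} ∑_{U ⊆ {0,…,N-1}, |U| = N-l} ∏_{u ∈ U} x^{q^u}`. -/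
noncomputable def explicitPoly {E : Type*} [Field E] (q T N : ℕ) (x : E) : E[X] :=
  ∑ l ∈ Finset.range (N + 1), X ^ (T * l) *
    C ((-1) ^ (N - l) *
      ∑ U ∈ Finset.powersetCard (N - l) (Finset.range N), ∏ u ∈ U, x ^ q ^ u)

end PowerComp

/-!
Let `Q` be the number of elements of `F(α)`. Up to conjugation, a root `γ` of `f (X ^ n)` satisfies
`γ ^ n = α`, and `b = γ ^ (n / d₁)` is a `d₁`-th root of `α`. Some power `γ ^ T` with
`T = n₁ / d₁ * v` equals an element `x = ζ₂ ^ i * b ^ (r * v)` of order dividing `Q ^ s - 1`, while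
every prime `p ∣ T` divides `ord x` and `p * ord x` does not divide `Q ^ s - 1`. Hence
`ord γ = T * ord x`, and by lifting the exponent the order of `q` modulo `ord γ` is also `T` times
its order modulo `ord x`. These two orders of `q` are the degrees of `γ` and `x`, so the minimal
polynomial of `γ` is that of `x` evaluated at `X ^ T`, which is the `q`-spin of `X ^ T - x`.

The order of `Q` modulo `ord b` is `s₁` and modulo `ord (ζ₂ ^ i)` it is `t_i`. So the conjugates of
`x` over `F(α)` move `b` along a cycle of length `s₁` and `ζ₂ ^ i` along one of length `t_i`, and
the pairs of positions in the two cycles split into `gcd (t_i, s₁)` orbits of length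
`lcm (t_i, s₁)`; the index `m` labels these orbits. As `f (X ^ n)` is separable, it is the product
of the distinct minimal polynomials of its roots.
-/

namespace PowerComp

open Polynomial

section MultiplicativeOrder

lemma sInf_pos_dvd (o : ℕ) : sInf {t : ℕ | 0 < t ∧ o ∣ t} = o := by
  rcases Nat.eq_zero_or_pos o with rfl | ho
  · have hempty : {t : ℕ | 0 < t ∧ 0 ∣ t} = ∅ :=
      Set.eq_empty_of_forall_notMem fun t ht => ht.1.ne' (zero_dvd_iff.1 ht.2)
    rw [hempty, Nat.sInf_empty]
  · exact le_antisymm (Nat.sInf_le ⟨ho, dvd_rfl⟩)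
      (le_csInf ⟨o, ho, dvd_rfl⟩ fun t ht => Nat.le_of_dvd ht.1 ht.2)

lemma dvd_pow_sub_one_iff_orderOf_dvd {M Q : ℕ} (hQ : 0 < Q) (t : ℕ) :
    M ∣ Q ^ t - 1 ↔ orderOf (Q : ZMod M) ∣ t := by
  rw [orderOf_dvd_iff_pow_eq_one, ← Nat.modEq_iff_dvd' (Nat.one_le_pow _ _ hQ),
    ← ZMod.natCast_eq_natCast_iff, eq_comm, Nat.cast_pow, Nat.cast_one]

lemma orderOf_natCast_pos {M Q : ℕ} (hM : 0 < M) (h : Q.Coprime M) :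
    0 < orderOf (Q : ZMod M) := by
  have : NeZero M := ⟨hM.ne'⟩
  exact (isOfFinOrder_iff_isUnit.2 ((ZMod.isUnit_iff_coprime Q M).2 h)).orderOf_pos

lemma orderOf_natCast_dvd_of_dvd {M M' : ℕ} (h : M ∣ M') (Q : ℕ) :
    orderOf (Q : ZMod M) ∣ orderOf (Q : ZMod M') := by
  simpa using orderOf_map_dvd (ZMod.castHom h (ZMod M) : ZMod M' →* ZMod M) (Q : ZMod M')

lemma orderOf_natCast_mul_of_coprime {a b : ℕ} (h : a.Coprime b) (Q : ℕ) :
    orderOf (Q : ZMod (a * b)) = Nat.lcm (orderOf (Q : ZMod a)) (orderOf (Q : ZMod b)) := by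
  rw [← (ZMod.chineseRemainder h).toMulEquiv.orderOf_eq (Q : ZMod (a * b)), Prod.orderOf]
  simp

lemma orderOf_natCast_eq_mul_of_dvd {M M' q : ℕ} (h : M ∣ M')
    (hM : 0 < orderOf (q : ZMod M)) :
    orderOf (q : ZMod M') =
      orderOf (q : ZMod M) * orderOf ((q ^ orderOf (q : ZMod M) : ℕ) : ZMod M') := by
  have hdvd := orderOf_natCast_dvd_of_dvd h q
  rw [Nat.cast_pow, orderOf_pow_of_dvd hM.ne' hdvd, Nat.mul_div_cancel' hdvd]

lemma two_dvd_orderOf_natCast {M Q : ℕ} (hodd : Odd Q) (hQ : ¬ Q ≡ 1 [MOD 4]) (hM : 4 ∣ M) :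
    2 ∣ orderOf (Q : ZMod M) := by
  have hsq : (Q : ZMod 4) ^ 2 = 1 := by
    have h4 : 4 ∣ Q ^ 2 - 1 := (by norm_num : 4 ∣ 8).trans (Nat.eight_dvd_sq_sub_one_of_odd hodd)
    rwa [dvd_pow_sub_one_iff_orderOf_dvd hodd.pos, orderOf_dvd_iff_pow_eq_one] at h4
  have hne : (Q : ZMod 4) ≠ 1 := fun h => hQ ((ZMod.natCast_eq_natCast_iff Q 1 4).1 (by simpa))
  exact orderOf_eq_prime hsq hne ▸ orderOf_natCast_dvd_of_dvd hM Q

end MultiplicativeOrder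

section LiftingTheExponent

lemma pow_sub_one_eq_mul_geom_sum {Q : ℕ} (hQ : 0 < Q) (t : ℕ) :
    Q ^ t - 1 = (Q - 1) * ∑ i ∈ Finset.range t, Q ^ i := by
  have h := geom_sum_mul_of_one_le (x := Q) hQ t
  rw [← h, mul_comm]

lemma emultiplicity_pow_sub_one {p Q : ℕ} (hp : p.Prime) (h : p ∣ Q - 1) (hQ : 0 < Q)
    (h4 : p = 2 → 4 ∣ Q - 1) (t : ℕ) :
    emultiplicity p (Q ^ t - 1) = emultiplicity p (Q - 1) + emultiplicity p t := by
  have hpQ : ¬ p ∣ Q := fun h' =>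
    hp.one_lt.ne' (Nat.dvd_one.1 ((Nat.dvd_sub_iff_right hQ h').1 h))
  rcases hp.eq_two_or_odd' with rfl | hodd
  · have key := Int.two_pow_sub_pow' (x := Q) (y := 1) t
      (by have := h4 rfl; zify [hQ] at this; exact this) (by exact_mod_cast hpQ)
    rw [one_pow] at key
    rw [← Int.natCast_emultiplicity, ← Int.natCast_emultiplicity 2 (Q - 1),
      ← Int.natCast_emultiplicity 2 t, Nat.cast_sub (Nat.one_le_pow _ _ hQ), Nat.cast_sub hQ]
    exact_mod_cast key
  · simpa only [one_pow] using Nat.emultiplicity_pow_sub_pow hp hodd (x := Q) (y := 1) h hpQ t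

lemma dvd_geom_sum_iff_of_dvd_sub_one {m Q : ℕ} (hQ : 0 < Q) (h : m ∣ Q - 1) (t : ℕ) :
    m ∣ ∑ i ∈ Finset.range t, Q ^ i ↔ m ∣ t := by
  have h1 : (Q : ZMod m) = 1 := by
    simpa using (ZMod.natCast_eq_natCast_iff _ _ _).2 ((Nat.modEq_iff_dvd' hQ).2 h).symm
  rw [← ZMod.natCast_eq_zero_iff, ← ZMod.natCast_eq_zero_iff]
  simp [h1]

lemma prime_pow_dvd_geom_sum_iff {p Q : ℕ} (hp : p.Prime) (h : p ∣ Q - 1) (hQ : 1 < Q)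
    (h4 : p = 2 → 4 ∣ Q - 1) (t a : ℕ) :
    p ^ a ∣ ∑ i ∈ Finset.range t, Q ^ i ↔ p ^ a ∣ t := by
  have hfin : emultiplicity p (Q - 1) ≠ ⊤ :=
    finiteMultiplicity_iff_emultiplicity_ne_top.1
      (Nat.finiteMultiplicity_iff.2 ⟨hp.one_lt.ne', by omega⟩)
  have hLTE := emultiplicity_pow_sub_one hp h (by omega) h4 t
  rw [pow_sub_one_eq_mul_geom_sum (by omega), emultiplicity_mul hp.prime] at hLTE
  rw [pow_dvd_iff_le_emultiplicity, pow_dvd_iff_le_emultiplicity,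
    ENat.add_right_injective_of_ne_top hfin hLTE]

lemma dvd_geom_sum_iff {d Q : ℕ} (hQ : 1 < Q) (h : ∀ p, p.Prime → p ∣ d → p ∣ Q - 1)
    (h4 : 4 ∣ d → 4 ∣ Q - 1) (t : ℕ) :
    d ∣ ∑ i ∈ Finset.range t, Q ^ i ↔ d ∣ t := by
  have main : ∀ p a, p.Prime → p ^ a ∣ d →
      (p ^ a ∣ ∑ i ∈ Finset.range t, Q ^ i ↔ p ^ a ∣ t) := by
    intro p a hp hpa
    rcases Nat.lt_trichotomy a 1 with ha | rfl | ha
    · simp [Nat.lt_one_iff.1 ha]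
    · rw [pow_one] at hpa ⊢
      exact dvd_geom_sum_iff_of_dvd_sub_one (by omega) (h p hp hpa) t
    · have hpd : p ∣ d := (dvd_pow_self p (by omega)).trans hpa
      refine prime_pow_dvd_geom_sum_iff hp (h p hp hpd) hQ ?_ t a
      rintro rfl
      exact h4 ((pow_dvd_pow 2 ha).trans hpa)
  rw [Nat.dvd_iff_prime_pow_dvd_dvd, Nat.dvd_iff_prime_pow_dvd_dvd]
  exact forall₄_congr main

lemma dvd_mul_iff_div_gcd_dvd {d a m : ℕ} (hd : 0 < d) : d ∣ a * m ↔ d / Nat.gcd d a ∣ m := by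
  have hg : 0 < Nat.gcd d a := Nat.gcd_pos_of_pos_left _ hd
  rw [← (Nat.coprime_div_gcd_div_gcd hg).dvd_mul_left,
    ← Nat.mul_dvd_mul_iff_left (b := d / Nat.gcd d a) hg,
    Nat.mul_div_cancel' (Nat.gcd_dvd_left d a), ← mul_assoc,
    Nat.mul_div_cancel' (Nat.gcd_dvd_right d a)]

lemma orderOf_natCast_mul {e d Q : ℕ} (hQ : 1 < Q) (he : e ∣ Q - 1) (hd : 0 < d)
    (h : ∀ p, p.Prime → p ∣ d → p ∣ e) (h4 : 4 ∣ d → 4 ∣ Q - 1) :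
    orderOf (Q : ZMod (e * d)) = d / Nat.gcd d ((Q - 1) / e) := by
  have he0 : 0 < e := Nat.pos_of_dvd_of_pos he (by omega)
  have hdd : d / Nat.gcd d ((Q - 1) / e) ∣ d := Nat.div_dvd_of_dvd (Nat.gcd_dvd_left _ _)
  refine (Nat.dvd_right_iff_eq).1 fun t => ?_
  calc orderOf (Q : ZMod (e * d)) ∣ t
    _ ↔ e * d ∣ Q ^ t - 1 := (dvd_pow_sub_one_iff_orderOf_dvd (by omega) t).symm
    _ ↔ d ∣ (Q - 1) / e * ∑ i ∈ Finset.range t, Q ^ i := by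
      rw [pow_sub_one_eq_mul_geom_sum (by omega), ← Nat.mul_dvd_mul_iff_left (b := d) he0,
        ← mul_assoc, Nat.mul_div_cancel' he]
    _ ↔ d / Nat.gcd d ((Q - 1) / e) ∣ ∑ i ∈ Finset.range t, Q ^ i := dvd_mul_iff_div_gcd_dvd hd
    _ ↔ d / Nat.gcd d ((Q - 1) / e) ∣ t :=
      dvd_geom_sum_iff hQ (fun p hp hpd => (h p hp (hpd.trans hdd)).trans he)
        (fun hd4 => h4 (hd4.trans hdd)) t

lemma orderOf_natCast_mul_of_not_dvd {q M T u : ℕ} (hq : 1 < q) (hu : 0 < u)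
    (hM : M ∣ q ^ u - 1) (hT0 : 0 < T)
    (hT : ∀ p, p.Prime → p ∣ T → p ∣ M ∧ ¬ p * M ∣ q ^ u - 1) (h4 : 4 ∣ T → 4 ∣ q ^ u - 1) :
    orderOf (q : ZMod (M * T)) = orderOf (q : ZMod M) * T := by
  set N := orderOf (q : ZMod M)
  have hNu : N ∣ u := (dvd_pow_sub_one_iff_orderOf_dvd (by omega) u).1 hM
  have hN : 0 < N := Nat.pos_of_dvd_of_pos hNu hu
  have hMN : M ∣ q ^ N - 1 := (dvd_pow_sub_one_iff_orderOf_dvd (by omega) N).2 dvd_rfl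
  have hgcd : Nat.Coprime T ((q ^ N - 1) / M) := by
    refine Nat.coprime_of_dvd fun p hp hpT hpN => (hT p hp hpT).2 ?_
    rw [mul_comm]
    exact (Nat.mul_dvd_of_dvd_div hMN hpN).trans (Nat.pow_sub_one_dvd_pow_sub_one q hNu)
  have h4M : 4 ∣ T → 4 ∣ M := by
    intro h
    obtain ⟨a, ha⟩ := hM
    have h2a : Nat.Coprime 4 a := by
      refine Nat.Coprime.pow_left 2 (Nat.prime_two.coprime_iff_not_dvd.2 fun h2 => ?_)
      refine (hT 2 Nat.prime_two ((by norm_num : 2 ∣ 4).trans h)).2 ?_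
      rw [ha, mul_comm 2]
      exact mul_dvd_mul_left M h2
    exact h2a.dvd_of_dvd_mul_right (ha ▸ h4 h)
  rw [orderOf_natCast_eq_mul_of_dvd (dvd_mul_right M T) hN,
    orderOf_natCast_mul (Nat.one_lt_pow hN.ne' hq) hMN hT0 (fun p hp hpT => (hT p hp hpT).1)
      fun h => (h4M h).trans hMN, hgcd.gcd_eq_one, Nat.div_one]

end LiftingTheExponent

section Parameters

variable {Q n e n₁ n₂ s : ℕ}

lemma baseExt_pos (h : n.Coprime Q) : 0 < baseExt Q n :=
  orderOf_natCast_pos (Nat.radical_pos n)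
    (h.symm.coprime_dvd_right UniqueFactorizationMonoid.radical_dvd_self)

lemma baseExt_dvd_extDeg (Q n : ℕ) : baseExt Q n ∣ extDeg Q n := by
  unfold extDeg
  split_ifs
  exacts [dvd_rfl, dvd_mul_left _ _]

lemma extDeg_pos (h : n.Coprime Q) : 0 < extDeg Q n := by
  have := baseExt_pos h
  unfold extDeg
  split_ifs <;> omega

lemma prime_dvd_pow_sub_one_of_extDeg_dvd (hQ : 0 < Q) (hn : 0 < n) (hs : extDeg Q n ∣ s)
    {p : ℕ} (hp : p.Prime) (hpn : p ∣ n) : p ∣ Q ^ s - 1 :=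
  ((UniqueFactorizationMonoid.dvd_radical_iff_of_irreducible hp hn.ne').2 hpn).trans
    ((dvd_pow_sub_one_iff_orderOf_dvd hQ s).2 ((baseExt_dvd_extDeg Q n).trans hs))

lemma four_dvd_pow_sub_one_of_extDeg_dvd (hQ : 0 < Q) (h : n.Coprime Q) (hs : extDeg Q n ∣ s)
    (h4 : 4 ∣ n) : 4 ∣ Q ^ s - 1 := by
  refine Dvd.dvd.trans ?_ (Nat.pow_sub_one_dvd_pow_sub_one Q hs)
  unfold extDeg
  split_ifs with hc
  · exact (Nat.modEq_iff_dvd' (Nat.one_le_pow _ _ hQ)).1 (hc.resolve_left (not_not.2 h4)).symm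
  · have hodd : Odd Q :=
      Nat.Coprime.odd_of_left (h.coprime_dvd_left ((by norm_num : 2 ∣ 4).trans h4))
    rw [mul_comm, pow_mul]
    exact (by norm_num : 4 ∣ 8).trans (Nat.eight_dvd_sq_sub_one_of_odd hodd.pow)

lemma dOne_dvd (Q e n₁ s : ℕ) : dOne Q e n₁ s ∣ n₁ := Nat.gcd_dvd_left _ _

lemma mul_dOne_dvd_pow_sub_one (n₁ : ℕ) (he : e ∣ Q ^ s - 1) :
    e * dOne Q e n₁ s ∣ Q ^ s - 1 :=
  Nat.mul_dvd_of_dvd_div he (Nat.gcd_dvd_right _ _)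

lemma dTwo_dvd (Q n₂ s : ℕ) : dTwo Q n₂ s ∣ n₂ := Nat.gcd_dvd_left _ _

lemma dTwo_dvd_pow_sub_one (Q n₂ s : ℕ) : dTwo Q n₂ s ∣ Q ^ s - 1 := Nat.gcd_dvd_right _ _

lemma gcd_dOne_eq_dOne_of_dvd (n₁ : ℕ) {m : ℕ} (he : e ∣ Q ^ m - 1) (hm : m ∣ s) :
    Nat.gcd (dOne Q e n₁ s) ((Q ^ m - 1) / e) = dOne Q e n₁ m := by
  have hdvd : (Q ^ m - 1) / e ∣ (Q ^ s - 1) / e :=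
    Nat.div_dvd_div he (Nat.pow_sub_one_dvd_pow_sub_one Q hm)
  rw [dOne, dOne, Nat.gcd_assoc, Nat.gcd_eq_right hdvd]

lemma dOne_div_dOne_eq_orderOf {m : ℕ} (hQ : 1 < Q) (hn₁ : 0 < n₁) (hm0 : 0 < m) (hm : m ∣ s)
    (he : e ∣ Q ^ m - 1) (h : ∀ p, p.Prime → p ∣ n₁ → p ∣ e)
    (h4 : 4 ∣ dOne Q e n₁ s → 4 ∣ Q ^ m - 1) :
    dOne Q e n₁ s / dOne Q e n₁ m =
      orderOf ((Q ^ m : ℕ) : ZMod (e * dOne Q e n₁ s)) := by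
  have hd : 0 < dOne Q e n₁ s := Nat.gcd_pos_of_pos_left _ hn₁
  rw [orderOf_natCast_mul (Nat.one_lt_pow hm0.ne' hQ) he hd
    (fun p hp hpd => h p hp (hpd.trans (dOne_dvd ..))) h4, gcd_dOne_eq_dOne_of_dvd n₁ he hm]

lemma sOne_eq_orderOf (hQ : 1 < Q) (hn₁ : 0 < n₁) (he : e ∣ Q - 1)
    (h : ∀ p, p.Prime → p ∣ n₁ → p ∣ e) :
    sOne Q e n₁ s = orderOf (Q : ZMod (e * dOne Q e n₁ s)) := by
  have he' : ∀ m, e ∣ Q ^ m - 1 := fun m => he.trans (Nat.sub_one_dvd_pow_sub_one Q m)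
  unfold sOne
  split_ifs with hc
  · have h4 : 4 ∣ dOne Q e n₁ s → 4 ∣ Q ^ 1 - 1 := fun h4 => by
      simpa using (Nat.modEq_iff_dvd' hQ.le).1 (hc.resolve_left (not_not.2 h4)).symm
    simpa using dOne_div_dOne_eq_orderOf hQ hn₁ one_pos (one_dvd s) (he' 1) h h4
  · push Not at hc
    obtain ⟨h4, hQ4⟩ := hc
    have hodd : Odd Q := by
      have h2 : 2 ∣ Q - 1 :=
        (h 2 Nat.prime_two (((by norm_num : 2 ∣ 4).trans h4).trans (dOne_dvd ..))).trans he
      rw [Nat.odd_iff]; omega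
    have h4M : 4 ∣ e * dOne Q e n₁ s := h4.trans (dvd_mul_left _ _)
    have h2s : 2 ∣ s := (two_dvd_orderOf_natCast hodd hQ4 h4M).trans
      ((dvd_pow_sub_one_iff_orderOf_dvd (by omega) s).1 (mul_dOne_dvd_pow_sub_one n₁ (he' s)))
    have hdvd : dOne Q e n₁ 2 ∣ dOne Q e n₁ s :=
      gcd_dOne_eq_dOne_of_dvd n₁ (he' 2) h2s ▸ Nat.gcd_dvd_left _ _
    have h42 : 4 ∣ Q ^ 2 - 1 := (by norm_num : 4 ∣ 8).trans (Nat.eight_dvd_sq_sub_one_of_odd hodd)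
    rw [Nat.mul_div_assoc _ hdvd,
      dOne_div_dOne_eq_orderOf hQ hn₁ two_pos h2s (he' 2) h fun _ => h42, Nat.cast_pow,
      orderOf_pow_of_dvd two_ne_zero (two_dvd_orderOf_natCast hodd hQ4 h4M),
      Nat.mul_div_cancel' (two_dvd_orderOf_natCast hodd hQ4 h4M)]

lemma tNum_eq_orderOf (hQ : 0 < Q) (hn₂ : 0 < n₂) (i : ℕ) :
    tNum Q n₂ s i = orderOf (Q : ZMod (dTwo Q n₂ s / Nat.gcd i (dTwo Q n₂ s))) := by
  have hd : 0 < dTwo Q n₂ s := Nat.gcd_pos_of_pos_left _ hn₂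
  have hdvd : dTwo Q n₂ s / Nat.gcd i (dTwo Q n₂ s) ∣ n₂ :=
    (Nat.div_dvd_of_dvd (Nat.gcd_dvd_right _ _)).trans (dTwo_dvd ..)
  rw [tNum, ← sInf_pos_dvd (orderOf (Q : ZMod (dTwo Q n₂ s / Nat.gcd i (dTwo Q n₂ s))))]
  congr! 4 with t
  rw [dvd_mul_iff_div_gcd_dvd hd, Nat.gcd_comm (dTwo Q n₂ s) i,
    ← dvd_pow_sub_one_iff_orderOf_dvd hQ, dTwo.eq_def Q n₂ t, Nat.dvd_gcd_iff]
  exact and_iff_right hdvd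

end Parameters

section OrderOf

lemma orderOf_eq_mul_of_prime_dvd {G : Type*} [Monoid G] {γ : G} {T : ℕ} (hT : 0 < T)
    (h : ∀ p, p.Prime → p ∣ T → p ∣ orderOf (γ ^ T)) : orderOf γ = orderOf (γ ^ T) * T := by
  have hord := orderOf_pow' γ hT.ne'
  have hg : 0 < Nat.gcd (orderOf γ) T := Nat.gcd_pos_of_pos_right _ hT
  have hco : Nat.Coprime (orderOf (γ ^ T)) (T / Nat.gcd (orderOf γ) T) :=
    hord ▸ Nat.coprime_div_gcd_div_gcd hg
  have hone : T / Nat.gcd (orderOf γ) T = 1 := by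
    by_contra hne
    obtain ⟨p, hp, hpd⟩ := Nat.exists_prime_and_dvd hne
    exact Nat.not_coprime_of_dvd_of_dvd hp.one_lt
      (h p hp (hpd.trans (Nat.div_dvd_of_dvd (Nat.gcd_dvd_right _ _)))) hpd hco
  have hgT : Nat.gcd (orderOf γ) T = T :=
    (Nat.eq_of_dvd_of_div_eq_one (Nat.gcd_dvd_right _ _) hone)
  rw [hord, hgT, Nat.div_mul_cancel (Nat.gcd_eq_right_iff_dvd.1 hgT)]

lemma pow_pow_eq_pow_pow_iff {G : Type*} [Monoid G] {x : G} (hx : IsOfFinOrder x) {Q : ℕ}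
    (hQ : Q.Coprime (orderOf x)) (a b : ℕ) :
    x ^ Q ^ a = x ^ Q ^ b ↔ a ≡ b [MOD orderOf (Q : ZMod (orderOf x))] := by
  have : NeZero (orderOf x) := ⟨hx.orderOf_pos.ne'⟩
  rw [hx.pow_eq_pow_iff_modEq, ← ZMod.natCast_eq_natCast_iff, Nat.cast_pow, Nat.cast_pow,
    (isOfFinOrder_iff_isUnit.2 ((ZMod.isUnit_iff_coprime _ _).2 hQ)).pow_eq_pow_iff_modEq]

end OrderOf

section Polynomials

lemma polyOrder_minpoly {F E : Type*} [Field F] [Field E] [Algebra F E] (γ : E) :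
    polyOrder (minpoly F γ) = orderOf γ := by
  rw [polyOrder, ← sInf_pos_dvd (orderOf γ)]
  congr! 4 with e
  rw [minpoly.dvd_iff, orderOf_dvd_iff_pow_eq_one]
  simp [sub_eq_zero]

lemma minpoly_eq_expand {F E : Type*} [Field F] [Field E] [Algebra F E] {γ : E}
    (hγ : IsIntegral F γ) {T : ℕ}
    (h : (minpoly F γ).natDegree = (minpoly F (γ ^ T)).natDegree * T) :
    minpoly F γ = expand F T (minpoly F (γ ^ T)) := by
  have hT : 0 < T := Nat.pos_of_mul_pos_left (h ▸ minpoly.natDegree_pos hγ)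
  refine (eq_of_monic_of_dvd_of_natDegree_le (minpoly.monic hγ)
    ((minpoly.monic (hγ.pow T)).expand hT) (minpoly.dvd F γ ?_) ?_).symm
  · rw [expand_aeval, minpoly.aeval]
  · rw [natDegree_expand, h]

lemma prod_binomial_eq_explicitPoly {E : Type*} [Field E] (q T N : ℕ) (x : E) :
    ∏ u ∈ Finset.range N, (X ^ T - C (x ^ q ^ u)) = explicitPoly q T N x := by
  simp_rw [explicitPoly, sub_eq_neg_add]
  rw [Finset.prod_add, Finset.sum_powerset, Finset.card_range, ← Finset.sum_range_reflect]
  refine Finset.sum_congr rfl fun l hl => ?_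
  have hl' : l ≤ N := Nat.lt_succ_iff.1 (Finset.mem_range.1 hl)
  rw [Nat.add_sub_cancel, C_mul, map_sum, Finset.mul_sum, Finset.mul_sum]
  refine Finset.sum_congr rfl fun U hU => ?_
  rw [Finset.mem_powersetCard] at hU
  rw [Finset.prod_const, Finset.card_sdiff_of_subset hU.1, Finset.card_range, hU.2,
    Nat.sub_sub_self hl', Finset.prod_neg, hU.2, map_prod]
  simp only [map_pow, map_neg, map_one]
  ring

lemma eq_prod_of_separable {F E ι : Type*} [Field F] [Field E] [Algebra F E] [IsAlgClosed E]
    {s : Finset ι} {P : ι → F[X]} {G : F[X]} (hG : G.Monic) (hsep : G.Separable)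
    (hmon : ∀ a ∈ s, (P a).Monic) (hirr : ∀ a ∈ s, Irreducible (P a))
    (hdvd : ∀ a ∈ s, P a ∣ G) (hinj : Set.InjOn P s)
    (hroot : ∀ γ : E, aeval γ G = 0 → ∃ a ∈ s, aeval γ (P a) = 0) :
    G = ∏ a ∈ s, P a := by
  have hPmon : (∏ a ∈ s, P a).Monic := monic_prod_of_monic _ _ hmon
  refine eq_of_monic_of_associated hG hPmon (associated_of_dvd_dvd ?_ ?_)
  · rw [← map_dvd_map' (algebraMap F E)]
    have h0 : G.map (algebraMap F E) ≠ 0 := (hG.map _).ne_zero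
    rw [(IsAlgClosed.splits _).dvd_iff_roots_le_roots h0 (hPmon.map _).ne_zero,
      Multiset.le_iff_subset (nodup_roots hsep.map)]
    intro γ hγ
    rw [mem_roots h0, IsRoot, eval_map_algebraMap] at hγ
    obtain ⟨a, ha, haγ⟩ := hroot γ hγ
    rw [mem_roots (hPmon.map _).ne_zero, IsRoot, eval_map_algebraMap, map_prod]
    exact Finset.prod_eq_zero ha haγ
  · refine Finset.prod_dvd_of_coprime (fun a ha b hb hab => ?_) hdvd
    rw [Function.onFun, (hirr a ha).coprime_iff_not_dvd]
    exact fun h => hab (hinj ha hb (eq_of_monic_of_associated (hmon a ha) (hmon b hb)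
      ((hirr a ha).associated_of_dvd (hirr b hb) h)))

end Polynomials

section FiniteField

lemma isUnit_natCast_of_coprime_card {R : Type*} [CommRing R] [Finite R] {n : ℕ}
    (h : n.Coprime (Nat.card R)) : IsUnit (n : R) := by
  have := Fintype.ofFinite R
  rw [← isCoprime_zero_right, ← Nat.cast_card_eq_zero R, ← Nat.card_eq_fintype_card]
  exact h.cast

variable {F E : Type*} [Field F] [Field E] [Algebra F E]

variable (F) in
lemma isIntegral_of_isOfFinOrder {γ : E} (hγ : IsOfFinOrder γ) : IsIntegral F γ :=
  IsIntegral.of_pow hγ.orderOf_pos (by rw [pow_orderOf_eq_one]; exact isIntegral_one)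

lemma adjoin_coeffs_binomial {T : ℕ} (hT : 0 < T) (x : E) :
    IntermediateField.adjoin F ((X ^ T - C x : E[X]).coeffs : Set E) =
      IntermediateField.adjoin F {x} := by
  apply le_antisymm
  · rw [IntermediateField.adjoin_le_iff]
    intro c hc
    rw [Finset.mem_coe, mem_coeffs_iff] at hc
    obtain ⟨m, -, rfl⟩ := hc
    rw [coeff_sub, coeff_X_pow, coeff_C]
    refine sub_mem ?_ ?_
    · split_ifs
      exacts [one_mem _, zero_mem _]
    · split_ifs
      exacts [IntermediateField.mem_adjoin_simple_self F x, zero_mem _]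
  · rw [IntermediateField.adjoin_simple_le_iff]
    by_cases hx : x = 0
    · rw [hx]; exact zero_mem _
    · have h0 : (X ^ T - C x : E[X]).coeff 0 = -x := by simp [coeff_X_pow, hT.ne]
      rw [← neg_mem_iff, ← h0]
      refine IntermediateField.subset_adjoin _ _ (coeff_mem_coeffs ?_)
      rw [h0]; exact neg_ne_zero.2 hx

lemma coeffDeg_binomial {T : ℕ} (hT : 0 < T) {x : E} (hx : IsIntegral F x) :
    coeffDeg F (X ^ T - C x) = (minpoly F x).natDegree := by
  rw [coeffDeg, adjoin_coeffs_binomial hT, IntermediateField.adjoin.finrank hx]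

variable [Finite F]

lemma aeval_pow_card_pow (P : F[X]) (γ : E) (u : ℕ) :
    aeval (γ ^ Nat.card F ^ u) P = aeval γ P ^ Nat.card F ^ u := by
  have := Fintype.ofFinite F
  induction u with
  | zero => simp
  | succ u ih =>
    rw [pow_succ (Nat.card F), pow_mul, ← expand_aeval, Nat.card_eq_fintype_card,
      FiniteField.expand_card, map_pow, ← Nat.card_eq_fintype_card, ih, pow_mul]

lemma minpoly_pow_card_pow {γ : E} (hγ : IsIntegral F γ) (u : ℕ) :
    minpoly F (γ ^ Nat.card F ^ u) = minpoly F γ := by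
  refine (minpoly.eq_of_irreducible_of_monic (minpoly.irreducible hγ) ?_ (minpoly.monic hγ)).symm
  rw [aeval_pow_card_pow, minpoly.aeval, zero_pow (Nat.pow_pos Nat.card_pos).ne']

lemma pow_card_pow_eq_self_iff {γ : E} (hγ : IsIntegral F γ) (u : ℕ) :
    γ ^ Nat.card F ^ u = γ ↔ (minpoly F γ).natDegree ∣ u := by
  rw [(minpoly.irreducible hγ).natDegree_dvd_iff_dvd_X_pow_card_pow_sub_X, minpoly.dvd_iff]
  simp [sub_eq_zero]

variable (F) in
lemma coprime_card_orderOf {γ : E} (hγ : IsOfFinOrder γ) : (Nat.card F).Coprime (orderOf γ) := by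
  have hint := isIntegral_of_isOfFinOrder F hγ
  have hdeg := minpoly.natDegree_pos hint
  have hdvd : orderOf γ ∣ Nat.card F ^ (minpoly F γ).natDegree - 1 := by
    rw [← Nat.modEq_iff_dvd' (Nat.one_le_pow _ _ Nat.card_pos), ← hγ.pow_eq_pow_iff_modEq,
      (pow_card_pow_eq_self_iff hint _).2 dvd_rfl, pow_one]
  refine (Nat.Coprime.coprime_dvd_right hdvd ?_)
  have h := Nat.coprime_self_sub_right
    (Nat.one_le_pow (minpoly F γ).natDegree (Nat.card F) Nat.card_pos)
  exact Nat.Coprime.coprime_dvd_left (dvd_pow_self _ hdeg.ne') (h.2 (Nat.coprime_one_right _))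

lemma isOfFinOrder_of_isIntegral {γ : E} (hγ : IsIntegral F γ) (h0 : γ ≠ 0) :
    IsOfFinOrder γ := by
  have hdeg := minpoly.natDegree_pos hγ
  have hQ : 1 < Nat.card F ^ (minpoly F γ).natDegree :=
    Nat.one_lt_pow hdeg.ne' Finite.one_lt_card
  refine isOfFinOrder_iff_pow_eq_one.2 ⟨_, Nat.sub_pos_of_lt hQ, mul_right_cancel₀ h0 ?_⟩
  rw [← pow_succ, Nat.sub_add_cancel hQ.le, one_mul, pow_card_pow_eq_self_iff hγ]

lemma pow_card_pow_eq_pow_card_pow_iff {γ : E} (hγ : IsOfFinOrder γ) (a b : ℕ) :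
    γ ^ Nat.card F ^ a = γ ^ Nat.card F ^ b ↔
      a ≡ b [MOD orderOf (Nat.card F : ZMod (orderOf γ))] :=
  pow_pow_eq_pow_pow_iff hγ (coprime_card_orderOf F hγ) a b

lemma natDegree_minpoly_eq_orderOf {γ : E} (hγ : IsOfFinOrder γ) :
    (minpoly F γ).natDegree = orderOf (Nat.card F : ZMod (orderOf γ)) := by
  refine Nat.dvd_right_iff_eq.1 fun u => ?_
  rw [← pow_card_pow_eq_self_iff (isIntegral_of_isOfFinOrder F hγ), ← Nat.modEq_zero_iff_dvd,
    ← pow_card_pow_eq_pow_card_pow_iff hγ, pow_zero, pow_one]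

lemma map_minpoly_eq_prod {γ : E} (hγ : IsOfFinOrder γ) :
    (minpoly F γ).map (algebraMap F E) =
      ∏ u ∈ Finset.range (minpoly F γ).natDegree, (X - C (γ ^ Nat.card F ^ u)) := by
  have hint := isIntegral_of_isOfFinOrder F hγ
  have hmon : ∀ u ∈ Finset.range (minpoly F γ).natDegree,
      (X - C (γ ^ Nat.card F ^ u) : E[X]).Monic := fun u _ => monic_X_sub_C _
  refine eq_of_monic_of_dvd_of_natDegree_le (monic_prod_of_monic _ _ hmon)
    ((minpoly.monic hint).map _) (Finset.prod_dvd_of_coprime ?_ ?_) ?_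
  · intro a ha b hb hab
    refine isCoprime_X_sub_C_of_isUnit_sub (Ne.isUnit (sub_ne_zero.2 fun h => hab ?_))
    rw [pow_card_pow_eq_pow_card_pow_iff hγ, ← natDegree_minpoly_eq_orderOf hγ] at h
    exact h.eq_of_lt_of_lt (Finset.mem_range.1 ha) (Finset.mem_range.1 hb)
  · intro u _
    rw [dvd_iff_isRoot, IsRoot, eval_map_algebraMap, ← minpoly_pow_card_pow hint u, minpoly.aeval]
  · rw [natDegree_map, natDegree_prod_of_monic _ _ hmon]
    simp only [natDegree_X_sub_C, Finset.sum_const, Finset.card_range, smul_eq_mul, mul_one,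
      le_refl]

lemma exists_eq_pow_card_pow_of_minpoly_eq {γ δ : E} (hδ : IsOfFinOrder δ)
    (h : minpoly F γ = minpoly F δ) : ∃ u, γ = δ ^ Nat.card F ^ u := by
  have hroot : eval γ ((minpoly F δ).map (algebraMap F E)) = 0 := by
    rw [eval_map_algebraMap, ← h, minpoly.aeval]
  rw [map_minpoly_eq_prod hδ, eval_prod, Finset.prod_eq_zero_iff] at hroot
  obtain ⟨u, -, hu⟩ := hroot
  exact ⟨u, by simpa [sub_eq_zero] using hu⟩

lemma map_expand_minpoly_eq_prod {x : E} (hx : IsOfFinOrder x) (T : ℕ) :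
    (expand F T (minpoly F x)).map (algebraMap F E) =
      ∏ u ∈ Finset.range (minpoly F x).natDegree, (X ^ T - C (x ^ Nat.card F ^ u)) := by
  rw [map_expand, map_minpoly_eq_prod hx, map_prod]
  simp

variable (F) in
lemma twist_binomial (j T : ℕ) (x : E) :
    twist (Nat.card F) j (X ^ T - C x) = X ^ T - C (x ^ Nat.card F ^ j) := by
  have := Fintype.ofFinite F
  have hφ : ∀ y : E, ((FiniteField.frobeniusAlgHom F E : E →+* E) ^ j) y = y ^ Nat.card F ^ j := by
    intro y
    rw [Nat.card_eq_fintype_card, RingHom.coe_pow, AlgHom.coe_toRingHom,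
      FiniteField.coe_frobeniusAlgHom, pow_iterate]
  have hmap : ∀ h : E[X], twist (Nat.card F) j h =
      h.map ((FiniteField.frobeniusAlgHom F E : E →+* E) ^ j) := by
    intro h
    rw [twist, Polynomial.map, eval₂_eq_sum]
    simp only [← C_mul_X_pow_eq_monomial, RingHom.comp_apply, hφ]
  rw [hmap, Polynomial.map_sub, Polynomial.map_pow, map_X, map_C, hφ]

lemma map_expand_minpoly_eq_spin {T : ℕ} (hT : 0 < T) {x : E} (hx : IsOfFinOrder x) :
    (expand F T (minpoly F x)).map (algebraMap F E) = spin F (X ^ T - C x) := by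
  rw [map_expand_minpoly_eq_prod hx, spin, coeffDeg_binomial hT (isIntegral_of_isOfFinOrder F hx)]
  exact Finset.prod_congr rfl fun u _ => (twist_binomial F u T x).symm

lemma minpoly_eq_expand_of_not_dvd {γ : E} (hγ : IsOfFinOrder γ) {T u : ℕ} (hT0 : 0 < T)
    (hu : 0 < u) (hx : orderOf (γ ^ T) ∣ Nat.card F ^ u - 1)
    (hT : ∀ p, p.Prime → p ∣ T →
      p ∣ orderOf (γ ^ T) ∧ ¬ p * orderOf (γ ^ T) ∣ Nat.card F ^ u - 1)
    (h4 : 4 ∣ T → 4 ∣ Nat.card F ^ u - 1) :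
    minpoly F γ = expand F T (minpoly F (γ ^ T)) := by
  refine minpoly_eq_expand (isIntegral_of_isOfFinOrder F hγ) ?_
  rw [natDegree_minpoly_eq_orderOf hγ, natDegree_minpoly_eq_orderOf hγ.pow,
    orderOf_eq_mul_of_prime_dvd hT0 fun p hp hpT => (hT p hp hpT).1,
    orderOf_natCast_mul_of_not_dvd Finite.one_lt_card hu hx hT0 hT h4]

end FiniteField

section Coprimality

lemma coprime_of_gcd_coprime {d i v : ℕ} (hv : ∀ p, p.Prime → p ∣ v → p ∣ d)
    (h : (Nat.gcd d i).Coprime v) : i.Coprime v :=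
  Nat.Coprime.symm <| Nat.coprime_of_dvd fun p hp hpv hpi =>
    Nat.not_coprime_of_dvd_of_dvd hp.one_lt (Nat.dvd_gcd (hv p hp hpv) hpi) hpv h

lemma coprime_of_modEq_mul {d i i' v c : ℕ} (hv : ∀ p, p.Prime → p ∣ v → p ∣ d)
    (h : i' ≡ i * c [MOD d]) (hi' : i'.Coprime v) : i.Coprime v := by
  refine coprime_of_gcd_coprime hv (hi'.coprime_dvd_left ?_)
  calc Nat.gcd d i ∣ Nat.gcd d (i * c) := Nat.gcd_dvd_gcd_mul_right_right _ _ _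
    _ = Nat.gcd d i' := by rw [Nat.gcd_comm, ← h.gcd_eq, Nat.gcd_comm]
    _ ∣ i' := Nat.gcd_dvd_right _ _

lemma not_prime_mul_gcd_dvd {p n A : ℕ} (hp : p.Prime) (hn : 0 < n) (h : p ∣ n / Nat.gcd n A) :
    ¬ p * Nat.gcd n A ∣ A := by
  intro hA
  have hg : 0 < Nat.gcd n A := Nat.gcd_pos_of_pos_left _ hn
  have hpn : p * Nat.gcd n A ∣ n := by
    rw [mul_comm]
    exact Nat.mul_dvd_of_dvd_div (Nat.gcd_dvd_left _ _) h
  have hdvd : p * Nat.gcd n A ∣ 1 * Nat.gcd n A := by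
    rw [one_mul]
    exact Nat.dvd_gcd hpn hA
  exact hp.not_dvd_one ((Nat.mul_dvd_mul_iff_right hg).1 hdvd)

lemma prime_mul_dvd_of_dvd {p d g A : ℕ} (hp : p.Prime) (hg : g ∣ d) (hpg : ¬ p ∣ g)
    (hA : d ∣ A) (h : p * (d / g) ∣ A) : p * d ∣ A := by
  obtain ⟨b, rfl⟩ := hg
  rcases Nat.eq_zero_or_pos (g * b) with h0 | h0
  · rwa [h0, mul_zero, ← h0]
  rw [Nat.mul_div_cancel_left _ (Nat.pos_of_mul_pos_right h0)] at h
  obtain ⟨B, rfl⟩ := (dvd_mul_left b p).trans h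
  have hb : 0 < b := Nat.pos_of_mul_pos_left h0
  rw [mul_comm p b, Nat.mul_dvd_mul_iff_left hb] at h
  rw [mul_comm g b, Nat.mul_dvd_mul_iff_left hb] at hA
  calc p * (g * b) = b * (p * g) := by ring
    _ ∣ b * B :=
      mul_dvd_mul_left b (((Nat.Prime.coprime_iff_not_dvd hp).2 hpg).mul_dvd_of_dvd_of_dvd h hA)

lemma gcd_mul_div_gcd {d i v : ℕ} (h : i.Coprime v) :
    Nat.gcd (v * (d / Nat.gcd i d)) d = d / Nat.gcd i d := by
  have hco : v.Coprime (Nat.gcd i d) := (h.coprime_dvd_left (Nat.gcd_dvd_left i d)).symm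
  calc Nat.gcd (v * (d / Nat.gcd i d)) d
      = Nat.gcd (v * (d / Nat.gcd i d)) (Nat.gcd i d * (d / Nat.gcd i d)) := by
        rw [Nat.mul_div_cancel' (Nat.gcd_dvd_right i d)]
    _ = d / Nat.gcd i d := by rw [Nat.gcd_mul_right, hco, one_mul]

lemma eq_of_mul_div_gcd_eq {d i i' v v' : ℕ} (hd : 0 < d) (hi : i.Coprime v) (hi' : i'.Coprime v')
    (h : v * (d / Nat.gcd i d) = v' * (d / Nat.gcd i' d)) : v = v' := by
  have hdiv : d / Nat.gcd i d = d / Nat.gcd i' d := by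
    rw [← gcd_mul_div_gcd hi, h, gcd_mul_div_gcd hi']
  rw [hdiv] at h
  exact Nat.eq_of_mul_eq_mul_right (Nat.div_pos (Nat.gcd_le_right _ hd)
    (Nat.gcd_pos_of_pos_right _ hd)) h

lemma exists_lt_gcd_add_modEq {t s : ℕ} (ht : 0 < t) (l a : ℕ) :
    ∃ m < Nat.gcd t s, ∃ u, u ≡ a [MOD s] ∧ m + u ≡ l [MOD t] := by
  set g := Nat.gcd t s with hg
  have hg0 : 0 < g := Nat.gcd_pos_of_pos_left _ ht
  set m := (l + a * (g - 1)) % g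
  have hma : m + a ≡ l [MOD g] := by
    calc m + a ≡ l + a * (g - 1) + a [MOD g] := (Nat.mod_modEq _ _).add_right a
      _ = l + g * a := by rw [add_assoc, ← Nat.mul_add_one, Nat.sub_add_cancel hg0, mul_comm]
      _ ≡ l [MOD g] := by simp [Nat.ModEq]
  have hml : m + (l + (t - 1) * m) ≡ l [MOD t] := by
    calc m + (l + (t - 1) * m) = l + t * m := by
          rw [add_comm, add_assoc, ← Nat.add_one_mul, Nat.sub_add_cancel ht]
      _ ≡ l [MOD t] := by simp [Nat.ModEq]
  have hcrt : a ≡ l + (t - 1) * m [MOD Nat.gcd s t] := by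
    rw [Nat.gcd_comm, ← hg]
    exact (hma.trans (hml.of_dvd (Nat.gcd_dvd_left t s)).symm).add_left_cancel' m
  obtain ⟨u, hua, hul⟩ := Nat.chineseRemainder' hcrt
  exact ⟨m, Nat.mod_lt _ hg0, u, hua, (hul.add_left m).trans hml⟩

end Coprimality

section RootsOfUnity

variable {E : Type*} [Field E] {d : ℕ} {ζ : E}

lemma pow_eq_pow_iff_modEq_of_isPrimitiveRoot (hd : 0 < d) (hζ : IsPrimitiveRoot ζ d) (a b : ℕ) :
    ζ ^ a = ζ ^ b ↔ a ≡ b [MOD d] := by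
  rw [(hζ.isOfFinOrder hd.ne').pow_eq_pow_iff_modEq, ← hζ.eq_orderOf]

lemma orderOf_pow_of_isPrimitiveRoot (hd : 0 < d) (hζ : IsPrimitiveRoot ζ d) (i : ℕ) :
    orderOf (ζ ^ i) = d / Nat.gcd i d := by
  rw [(hζ.isOfFinOrder hd.ne').orderOf_pow, ← hζ.eq_orderOf, Nat.gcd_comm]

-- The exponent `orderOf w / gcd (orderOf w) d` makes the two orders equal to the gcd.
lemma exists_coprime_pow_eq_pow (hd : 0 < d) (hζ : IsPrimitiveRoot ζ d) {w : E}
    (hw : IsOfFinOrder w) (h : ∀ p, p.Prime → p ∣ orderOf w → p ∣ d) :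
    ∃ v i, d * v = Nat.lcm (orderOf w) d ∧ i.Coprime v ∧ w ^ v = ζ ^ i := by
  have : NeZero d := ⟨hd.ne'⟩
  set o := orderOf w
  have ho0 : 0 < o := hw.orderOf_pos
  have hg0 : 0 < Nat.gcd o d := Nat.gcd_pos_of_pos_right _ hd
  have hgo : Nat.gcd o d ∣ o := Nat.gcd_dvd_left _ _
  have hvo : o / Nat.gcd o d ∣ o := Nat.div_dvd_of_dvd hgo
  have hord : orderOf (w ^ (o / Nat.gcd o d)) = Nat.gcd o d := by
    rw [orderOf_pow_of_dvd (Nat.div_pos (Nat.gcd_le_left _ ho0) hg0).ne' hvo,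
      Nat.div_div_self hgo ho0.ne']
  obtain ⟨i, -, hi⟩ := hζ.eq_pow_of_pow_eq_one (ξ := w ^ (o / Nat.gcd o d))
    (orderOf_dvd_iff_pow_eq_one.1 (by rw [hord]; exact Nat.gcd_dvd_right o d))
  refine ⟨o / Nat.gcd o d, i, ?_, coprime_of_gcd_coprime (d := d)
    (fun p hp hpv => h p hp (hpv.trans hvo)) ?_, hi.symm⟩
  · rw [Nat.lcm, ← Nat.mul_div_assoc _ hgo, mul_comm]
  · rw [← hi, orderOf_pow_of_isPrimitiveRoot hd hζ] at hord
    have hgcd : Nat.gcd d i = d / Nat.gcd o d := by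
      rw [← hord, Nat.div_div_self (Nat.gcd_dvd_right _ _) hd.ne', Nat.gcd_comm]
    rw [hgcd]
    exact (Nat.coprime_div_gcd_div_gcd hg0).symm

end RootsOfUnity

section Representatives

lemma expRel_iff {E : Type*} [Field E] {Q s : ℕ} {ζ β : E} (hQ : 0 < Q) (hβ : β ≠ 0)
    (j j' : ℕ) : expRel Q s ζ β j j' ↔ ∃ m < s, ζ ^ j' * β = (ζ ^ j * β) ^ Q ^ m := by
  refine exists_congr fun m => and_congr_right fun _ => ?_
  rw [mul_pow, ← pow_mul, ← pow_sub_one_mul (Nat.pow_pos hQ).ne' β, ← mul_assoc,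
    mul_left_inj' hβ]

lemma expRel_iff_exists {E : Type*} [Field E] {Q s : ℕ} {ζ β : E} (hQ : 0 < Q) (hβ : β ≠ 0)
    (hs : 0 < s) {j : ℕ} (hj : (ζ ^ j * β) ^ Q ^ s = ζ ^ j * β) (j' : ℕ) :
    expRel Q s ζ β j j' ↔ ∃ m, ζ ^ j' * β = (ζ ^ j * β) ^ Q ^ m := by
  rw [expRel_iff hQ hβ]
  refine ⟨fun ⟨m, _, h⟩ => ⟨m, h⟩, fun ⟨m, h⟩ => ⟨m % s, Nat.mod_lt m hs, ?_⟩⟩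
  have hper : Function.IsPeriodicPt (fun x : E => x ^ Q) s (ζ ^ j * β) := by
    rw [Function.IsPeriodicPt, Function.IsFixedPt, pow_iterate]
    exact hj
  have hmod := hper.iterate_mod_apply m
  simp only [pow_iterate] at hmod
  rw [hmod, h]

lemma equivalence_expRel {E : Type*} [Field E] {Q s : ℕ} {ζ β : E} (hQ : 0 < Q) (hβ : β ≠ 0)
    (hs : 0 < s) (h : ∀ j, (ζ ^ j * β) ^ Q ^ s = ζ ^ j * β) :
    Equivalence (expRel Q s ζ β) := by
  have hrel := fun j j' => expRel_iff_exists hQ hβ hs (h j) j'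
  constructor
  · exact fun j => (hrel j j).2 ⟨0, by rw [pow_zero, pow_one]⟩
  · intro j j' hjj'
    obtain ⟨m, hms, hm⟩ := (expRel_iff hQ hβ j j').1 hjj'
    refine (hrel j' j).2 ⟨s - m, ?_⟩
    rw [hm, ← pow_mul, ← pow_add, Nat.add_sub_cancel' hms.le, h]
  · intro j j' j'' hjj' hjj''
    obtain ⟨m, hm⟩ := (hrel j j').1 hjj'
    obtain ⟨m', hm'⟩ := (hrel j' j'').1 hjj''
    exact (hrel j j'').2 ⟨m + m', by rw [hm', hm, ← pow_mul, ← pow_add]⟩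

lemma IsRepSystem.eq_of_rel {d : ℕ} {r : ℕ → ℕ → Prop} {J : Finset ℕ} (hJ : IsRepSystem d r J)
    {j j' : ℕ} (hj : j ∈ J) (hj' : j' ∈ J) (hjj : r j j) (h : r j' j) : j = j' :=
  (hJ.2 j (hJ.1 j hj)).unique ⟨hj, hjj⟩ ⟨hj', h⟩

lemma IsCycloRepSystem.exists_modEq {Q d : ℕ} {I : Finset ℕ} (hI : IsCycloRepSystem Q d I)
    (hd : 0 < d) (a : ℕ) : ∃ i ∈ I, ∃ l, a ≡ i * Q ^ l [MOD d] := by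
  obtain ⟨i, ⟨hi, l, hl⟩, -⟩ := hI (a % d) (Nat.mod_lt a hd)
  exact ⟨i, hi, l, hl⟩

lemma IsCycloRepSystem.eq_of_modEq {Q d : ℕ} {I : Finset ℕ} (hI : IsCycloRepSystem Q d I)
    (hd : 0 < d) {i i' a b : ℕ} (hi : i ∈ I) (hi' : i' ∈ I)
    (h : i * Q ^ a ≡ i' * Q ^ b [MOD d]) : i = i' :=
  (hI _ (Nat.mod_lt _ hd)).unique ⟨hi, a, rfl⟩ ⟨hi', b, h⟩

end Representatives

/-- The situation in which `f (X ^ (n₁ * n₂))` is factored over the finite field `F`: `f` is the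
minimal polynomial of the root of unity `α`, and `s` may be any positive multiple of
`extDeg Q (n₁ * n₂)`, where `Q` is the number of elements of the field `F(α)`. -/
structure Setting (F E : Type*) [Field F] [Field E] [Algebra F E] where
  α : E
  n₁ : ℕ
  n₂ : ℕ
  s : ℕ
  isOfFinOrder_α : IsOfFinOrder α
  coprime_card : (n₁ * n₂).Coprime (Nat.card F)
  radical_dvd : UniqueFactorizationMonoid.radical n₁ ∣ orderOf α
  coprime_orderOf : n₂.Coprime (orderOf α)
  s_pos : 0 < s
  extDeg_dvd : extDeg (Nat.card F ^ (minpoly F α).natDegree) (n₁ * n₂) ∣ s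

namespace Setting

variable {F E : Type*} [Field F] [Field E] [Algebra F E] (D : Setting F E)

/-- The degree of `α` over `F`. -/
noncomputable def k : ℕ := (minpoly F D.α).natDegree

/-- The number of elements of the field `F(α)`. -/
noncomputable def Q : ℕ := Nat.card F ^ D.k

/-- The multiplicative order of `α`. -/
noncomputable def e : ℕ := orderOf D.α

/-- The number `d₁^{(s)}`. -/
noncomputable def d₁ : ℕ := dOne D.Q D.e D.n₁ D.s

/-- The number `d₂^{(s)}`. -/
noncomputable def d₂ : ℕ := dTwo D.Q D.n₂ D.s

/-- The number `s₁`, which is the order of `Q` modulo `e * d₁`. -/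
noncomputable def s₁ : ℕ := sOne D.Q D.e D.n₁ D.s

/-- The number `t_i`, which is the order of `Q` modulo `d₂ / gcd (i, d₂)`. -/
noncomputable def t (i : ℕ) : ℕ := tNum D.Q D.n₂ D.s i

/-- The multiplicative order of the elements `x_{(j,v,i,m)}`, which only depends on `i`. -/
noncomputable def ord (i : ℕ) : ℕ := D.e * D.d₁ * (D.d₂ / Nat.gcd i D.d₂)

section Parameters

lemma Q_pow (u : ℕ) : D.Q ^ u = Nat.card F ^ (D.k * u) := (pow_mul _ _ _).symm

lemma d₁_dvd : D.d₁ ∣ D.n₁ := dOne_dvd ..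

lemma d₂_dvd : D.d₂ ∣ D.n₂ := dTwo_dvd ..

lemma d₂_dvd_pow_sub_one : D.d₂ ∣ D.Q ^ D.s - 1 := dTwo_dvd_pow_sub_one ..

lemma d₂_div_gcd_dvd (i : ℕ) : D.d₂ / Nat.gcd i D.d₂ ∣ D.d₂ :=
  Nat.div_dvd_of_dvd (Nat.gcd_dvd_right _ _)

lemma e_pos : 0 < D.e := D.isOfFinOrder_α.orderOf_pos

lemma k_pos : 0 < D.k := minpoly.natDegree_pos (isIntegral_of_isOfFinOrder F D.isOfFinOrder_α)

lemma dvd_n₂_of_dvd_div {v : ℕ} (hv : v ∣ D.n₂ / D.d₂) : v ∣ D.n₂ :=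
  hv.trans (Nat.div_dvd_of_dvd D.d₂_dvd)

variable [Finite F]

lemma one_lt_Q : 1 < D.Q := Nat.one_lt_pow D.k_pos.ne' Finite.one_lt_card

lemma Q_pos : 0 < D.Q := one_pos.trans D.one_lt_Q

lemma n₁_mul_n₂_pos : 0 < D.n₁ * D.n₂ := by
  refine Nat.pos_of_ne_zero fun h => (Finite.one_lt_card (α := F)).ne' ?_
  rw [← Nat.coprime_zero_left, ← h]
  exact D.coprime_card

lemma n₁_pos : 0 < D.n₁ := Nat.pos_of_mul_pos_right D.n₁_mul_n₂_pos

lemma n₂_pos : 0 < D.n₂ := Nat.pos_of_mul_pos_left D.n₁_mul_n₂_pos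

lemma d₁_pos : 0 < D.d₁ := Nat.pos_of_dvd_of_pos D.d₁_dvd D.n₁_pos

lemma d₂_pos : 0 < D.d₂ := Nat.pos_of_dvd_of_pos D.d₂_dvd D.n₂_pos

lemma prime_dvd_e {p : ℕ} (hp : p.Prime) (h : p ∣ D.n₁) : p ∣ D.e :=
  ((UniqueFactorizationMonoid.dvd_radical_iff_of_irreducible hp D.n₁_pos.ne').2 h).trans
    D.radical_dvd

lemma prime_dvd_d₂ {p : ℕ} (hp : p.Prime) (h : p ∣ D.n₂) : p ∣ D.d₂ :=
  Nat.dvd_gcd h (prime_dvd_pow_sub_one_of_extDeg_dvd D.Q_pos D.n₁_mul_n₂_pos D.extDeg_dvd hp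
    (h.mul_left _))

lemma k_eq_orderOf : D.k = orderOf (Nat.card F : ZMod D.e) :=
  natDegree_minpoly_eq_orderOf D.isOfFinOrder_α

lemma e_dvd_Q_sub_one : D.e ∣ D.Q - 1 :=
  (dvd_pow_sub_one_iff_orderOf_dvd Nat.card_pos D.k).2 D.k_eq_orderOf.symm.dvd

lemma e_dvd_pow_sub_one (u : ℕ) : D.e ∣ D.Q ^ u - 1 :=
  D.e_dvd_Q_sub_one.trans (Nat.sub_one_dvd_pow_sub_one _ u)

lemma e_mul_d₁_dvd_pow_sub_one : D.e * D.d₁ ∣ D.Q ^ D.s - 1 :=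
  mul_dOne_dvd_pow_sub_one _ (D.e_dvd_pow_sub_one _)

lemma coprime_n₂ : D.n₂.Coprime (D.e * D.d₁) :=
  D.coprime_orderOf.mul_right <| Nat.coprime_of_dvd fun _ hp hpn hpd =>
    Nat.not_coprime_of_dvd_of_dvd hp.one_lt hpn (D.prime_dvd_e hp (hpd.trans D.d₁_dvd))
      D.coprime_orderOf

lemma coprime_d₂_div_gcd (i : ℕ) : (D.e * D.d₁).Coprime (D.d₂ / Nat.gcd i D.d₂) :=
  (D.coprime_n₂.coprime_dvd_left ((D.d₂_div_gcd_dvd i).trans D.d₂_dvd)).symm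

lemma s₁_eq_orderOf : D.s₁ = orderOf (D.Q : ZMod (D.e * D.d₁)) :=
  sOne_eq_orderOf D.one_lt_Q D.n₁_pos D.e_dvd_Q_sub_one fun _ => D.prime_dvd_e

lemma t_eq_orderOf (i : ℕ) : D.t i = orderOf (D.Q : ZMod (D.d₂ / Nat.gcd i D.d₂)) :=
  tNum_eq_orderOf D.Q_pos D.n₂_pos i

lemma s₁_pos : 0 < D.s₁ := by
  refine Nat.pos_of_dvd_of_pos ?_ D.s_pos
  rw [s₁_eq_orderOf, ← dvd_pow_sub_one_iff_orderOf_dvd D.Q_pos]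
  exact D.e_mul_d₁_dvd_pow_sub_one

lemma t_pos (i : ℕ) : 0 < D.t i := by
  refine Nat.pos_of_dvd_of_pos ?_ D.s_pos
  rw [t_eq_orderOf, ← dvd_pow_sub_one_iff_orderOf_dvd D.Q_pos]
  exact (D.d₂_div_gcd_dvd i).trans D.d₂_dvd_pow_sub_one

lemma ord_dvd_pow_sub_one (i : ℕ) : D.ord i ∣ D.Q ^ D.s - 1 :=
  (D.coprime_d₂_div_gcd i).mul_dvd_of_dvd_of_dvd D.e_mul_d₁_dvd_pow_sub_one
    ((D.d₂_div_gcd_dvd i).trans D.d₂_dvd_pow_sub_one)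

lemma orderOf_natCast_ord (i : ℕ) :
    orderOf (Nat.card F : ZMod (D.ord i)) = D.k * Nat.lcm (D.t i) D.s₁ := by
  have hdvd : D.e ∣ D.ord i := (dvd_mul_right _ _).mul_right _
  rw [orderOf_natCast_eq_mul_of_dvd hdvd (D.k_eq_orderOf ▸ D.k_pos), ← D.k_eq_orderOf, ← Q, ord,
    orderOf_natCast_mul_of_coprime (D.coprime_d₂_div_gcd i), ← s₁_eq_orderOf, ← t_eq_orderOf,
    Nat.lcm_comm]

variable {v i p : ℕ}

lemma prime_dvd_ord (hv : v ∣ D.n₂ / D.d₂) (hi : i.Coprime v) (hp : p.Prime)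
    (hpT : p ∣ D.n₁ / D.d₁ * v) : p ∣ D.ord i := by
  rcases hp.dvd_mul.1 hpT with h | h
  · exact ((D.prime_dvd_e hp (h.trans (Nat.div_dvd_of_dvd D.d₁_dvd))).mul_right _).mul_right _
  · have hpd := D.prime_dvd_d₂ hp (h.trans (D.dvd_n₂_of_dvd_div hv))
    rw [← Nat.mul_div_cancel' (Nat.gcd_dvd_right i D.d₂)] at hpd
    exact ((hp.dvd_mul.1 hpd).resolve_left fun hpg => Nat.not_coprime_of_dvd_of_dvd hp.one_lt
      (hpg.trans (Nat.gcd_dvd_left _ _)) h hi).mul_left _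

lemma not_prime_mul_ord_dvd (hv : v ∣ D.n₂ / D.d₂) (hi : i.Coprime v) (hp : p.Prime)
    (hpT : p ∣ D.n₁ / D.d₁ * v) : ¬ p * D.ord i ∣ D.Q ^ D.s - 1 := by
  intro h
  rcases hp.dvd_mul.1 hpT with hpn | hpv
  · refine not_prime_mul_gcd_dvd hp D.n₁_pos hpn ?_
    rw [Nat.dvd_div_iff_mul_dvd (D.e_dvd_pow_sub_one _), mul_left_comm]
    exact (mul_dvd_mul_left p (dvd_mul_right _ _)).trans h
  · have hpg : ¬ p ∣ Nat.gcd i D.d₂ := fun hpg => Nat.not_coprime_of_dvd_of_dvd hp.one_lt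
      (hpg.trans (Nat.gcd_dvd_left _ _)) hpv hi
    exact not_prime_mul_gcd_dvd hp D.n₂_pos (hpv.trans hv)
      (prime_mul_dvd_of_dvd hp (Nat.gcd_dvd_right i _) hpg D.d₂_dvd_pow_sub_one
        ((mul_dvd_mul_left p (dvd_mul_left _ _)).trans h))

lemma four_dvd_pow_sub_one (hv : v ∣ D.n₂ / D.d₂) (h : 4 ∣ D.n₁ / D.d₁ * v) :
    4 ∣ D.Q ^ D.s - 1 :=
  four_dvd_pow_sub_one_of_extDeg_dvd D.Q_pos (D.coprime_card.pow_right _) D.extDeg_dvd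
    (h.trans (mul_dvd_mul (Nat.div_dvd_of_dvd D.d₁_dvd) (D.dvd_n₂_of_dvd_div hv)))

end Parameters

section Roots

variable {b : E}

lemma zeta_pow_mul_pow {ζ : E} (hζ : ζ ^ D.d₁ = 1) (hb : b ^ D.d₁ = D.α) (j : ℕ) :
    (ζ ^ j * b) ^ D.d₁ = D.α := by
  rw [mul_pow, pow_right_comm, hζ, one_pow, one_mul, hb]

variable [Finite F]

lemma isOfFinOrder_of_pow_eq (hb : b ^ D.d₁ = D.α) : IsOfFinOrder b :=
  IsOfFinOrder.of_pow (hb ▸ D.isOfFinOrder_α) D.d₁_pos.ne'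

lemma orderOf_of_pow_eq (hb : b ^ D.d₁ = D.α) : orderOf b = D.e * D.d₁ := by
  rw [orderOf_eq_mul_of_prime_dvd D.d₁_pos, hb, e]
  exact fun p hp hpd => hb ▸ D.prime_dvd_e hp (hpd.trans D.d₁_dvd)

lemma pow_Q_pow_eq_iff (hb : b ^ D.d₁ = D.α) (a c : ℕ) :
    b ^ D.Q ^ a = b ^ D.Q ^ c ↔ a ≡ c [MOD D.s₁] := by
  have hord := D.orderOf_of_pow_eq hb
  rw [pow_pow_eq_pow_pow_iff (D.isOfFinOrder_of_pow_eq hb), hord, s₁_eq_orderOf]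
  exact (coprime_card_orderOf F (D.isOfFinOrder_of_pow_eq hb)).pow_left _

lemma pow_Q_pow_s_eq (hb : b ^ D.d₁ = D.α) : b ^ D.Q ^ D.s = b := by
  refine Eq.trans ((D.pow_Q_pow_eq_iff hb D.s 0).2 ?_) (by rw [pow_zero, pow_one])
  rw [Nat.modEq_zero_iff_dvd, s₁_eq_orderOf, ← dvd_pow_sub_one_iff_orderOf_dvd D.Q_pos]
  exact D.e_mul_d₁_dvd_pow_sub_one

lemma pow_Q_pow_s₁_eq (hb : b ^ D.d₁ = D.α) : b ^ D.Q ^ D.s₁ = b :=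
  ((D.pow_Q_pow_eq_iff hb D.s₁ 0).2 (Nat.modEq_zero_iff_dvd.2 dvd_rfl)).trans
    (by rw [pow_zero, pow_one])

lemma ne_zero_of_pow_eq (hb : b ^ D.d₁ = D.α) : b ≠ 0 :=
  (D.isOfFinOrder_of_pow_eq hb).isUnit.ne_zero

lemma equivalence_expRel {ζ β : E} (hζ : ζ ^ D.d₁ = 1) (hβ : β ^ D.d₁ = D.α) :
    Equivalence (expRel D.Q D.s₁ ζ β) :=
  PowerComp.equivalence_expRel D.Q_pos (D.ne_zero_of_pow_eq hβ) D.s₁_pos fun j =>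
    D.pow_Q_pow_s₁_eq (D.zeta_pow_mul_pow hζ hβ j)

lemma pow_card_pow_mul_eq (hb : b ^ D.d₁ = D.α) : b ^ Nat.card F ^ (D.k * D.s) = b := by
  rw [← D.Q_pow, D.pow_Q_pow_s_eq hb]

lemma e_mul_d₁_eq_one (h : minpoly F D.α = X - 1) : D.e * D.d₁ = 1 := by
  have hα : D.α = 1 := by simpa [h, sub_eq_zero] using minpoly.aeval F D.α
  have he : D.e = 1 := by rw [e, hα, orderOf_one]
  rw [he, one_mul, Nat.eq_one_iff_not_exists_prime_dvd]
  intro p hp hpd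
  exact hp.not_dvd_one (he ▸ D.prime_dvd_e hp (hpd.trans D.d₁_dvd))

lemma exists_exponent : ∃ r, 0 < r ∧ ((minpoly F D.α = X - 1 ∧ r = 1) ∨
    (minpoly F D.α ≠ X - 1 ∧ r * D.n₂ ≡ 1 [MOD D.e * D.d₁])) := by
  by_cases h : minpoly F D.α = X - 1
  · exact ⟨1, one_pos, Or.inl ⟨h, rfl⟩⟩
  have hpos : 0 < D.e * D.d₁ := Nat.mul_pos D.e_pos D.d₁_pos
  obtain ⟨r, -, hr⟩ := Nat.exists_mul_mod_eq_of_coprime 1 D.coprime_n₂ hpos.ne'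
  refine ⟨r + D.e * D.d₁, Nat.add_pos_right _ hpos, Or.inr ⟨h, ?_⟩⟩
  calc (r + D.e * D.d₁) * D.n₂ = D.n₂ * r + D.e * D.d₁ * D.n₂ := by ring
    _ ≡ D.n₂ * r [MOD D.e * D.d₁] := Nat.add_mul_mod_self_left _ _ _
    _ ≡ 1 [MOD D.e * D.d₁] := hr

lemma mul_n₂_modEq_one {r : ℕ} (hr : (minpoly F D.α = X - 1 ∧ r = 1) ∨
    (minpoly F D.α ≠ X - 1 ∧ r * D.n₂ ≡ 1 [MOD D.e * D.d₁])) :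
    r * D.n₂ ≡ 1 [MOD D.e * D.d₁] := by
  rcases hr with ⟨h, -⟩ | ⟨-, hr⟩
  · rw [D.e_mul_d₁_eq_one h]
    exact Nat.modEq_one
  · exact hr

end Roots

end Setting

/-- A `Setting` together with the choices that label the irreducible factors: the primitive roots
of unity `ζ₁` and `ζ₂`, a `d₁`-th root `β` of `α`, and an inverse `r` of `n₂` modulo `e * d₁`. -/
structure RootData (F E : Type*) [Field F] [Field E] [Algebra F E] extends Setting F E where
  ζ₁ : E
  ζ₂ : E
  β : E
  r : ℕ
  isPrimitiveRoot_ζ₁ : IsPrimitiveRoot ζ₁ toSetting.d₁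
  isPrimitiveRoot_ζ₂ : IsPrimitiveRoot ζ₂ toSetting.d₂
  β_pow_d₁ : β ^ toSetting.d₁ = α
  r_mul_n₂ : r * n₂ ≡ 1 [MOD toSetting.e * toSetting.d₁]

namespace RootData

variable {F E : Type*} [Field F] [Field E] [Algebra F E] (D : RootData F E)

/-- The exponent of the binomial attached to `v`. -/
noncomputable def exponent (v : ℕ) : ℕ := D.n₁ / D.d₁ * v

/-- The `d₁`-th root of `α` labelled by `j`. -/
def base (j : ℕ) : E := D.ζ₁ ^ j * D.β

/-- The element `x_{(j,v,i,m)}`. -/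
noncomputable def const (j v i m : ℕ) : E := D.ζ₂ ^ (i * D.Q ^ m) * D.base j ^ (D.r * v)

/-- The polynomial `S_{(j,v,i,m)}`, defined over `F` from the start. -/
noncomputable def factor (j v i m : ℕ) : F[X] :=
  expand F (D.exponent v) (minpoly F (D.const j v i m))

section Constants

lemma base_pow_d₁ (j : ℕ) : D.base j ^ D.d₁ = D.α :=
  D.zeta_pow_mul_pow D.isPrimitiveRoot_ζ₁.pow_eq_one D.β_pow_d₁ j

lemma coprime_r : D.r.Coprime (D.e * D.d₁) :=
  Nat.Coprime.coprime_mul_right (k := D.n₂) (D.r_mul_n₂.gcd_eq.trans (Nat.gcd_one_left _))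

lemma coprime_Q_d₂ : D.Q.Coprime D.d₂ :=
  ((D.coprime_card.coprime_mul_left.symm.coprime_dvd_right D.d₂_dvd)).pow_left _

lemma const_pow_Q_pow (j v i m u : ℕ) :
    D.const j v i m ^ D.Q ^ u = D.ζ₂ ^ (i * D.Q ^ (m + u)) * (D.base j ^ D.Q ^ u) ^ (D.r * v) := by
  rw [const, mul_pow, ← pow_mul D.ζ₂, mul_assoc i, ← pow_add, pow_right_comm (D.base j)]

variable [Finite F]

lemma exists_base_eq {b : E} (hb : b ^ D.d₁ = D.α) : ∃ j < D.d₁, D.base j = b := by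
  have : NeZero D.d₁ := ⟨D.d₁_pos.ne'⟩
  have hβ0 : D.β ≠ 0 := D.ne_zero_of_pow_eq D.β_pow_d₁
  have hdiv : (b / D.β) ^ D.d₁ = 1 := by
    rw [div_pow, hb, D.β_pow_d₁, div_self D.isOfFinOrder_α.isUnit.ne_zero]
  obtain ⟨j, hj, hζ⟩ := D.isPrimitiveRoot_ζ₁.eq_pow_of_pow_eq_one hdiv
  exact ⟨j, hj, by rw [base, hζ, div_mul_cancel₀ _ hβ0]⟩

lemma expRel_iff_exists_base (j j' : ℕ) :
    expRel D.Q D.s₁ D.ζ₁ D.β j j' ↔ ∃ m, D.base j' = D.base j ^ D.Q ^ m :=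
  expRel_iff_exists D.Q_pos (D.ne_zero_of_pow_eq D.β_pow_d₁) D.s₁_pos
    (D.pow_Q_pow_s₁_eq (D.base_pow_d₁ j)) j'

lemma pow_r_mul_n₂ {b : E} (hb : b ^ D.d₁ = D.α) : b ^ (D.r * D.n₂) = b := by
  conv_rhs => rw [← pow_one b]
  rw [(D.isOfFinOrder_of_pow_eq hb).pow_eq_pow_iff_modEq, D.orderOf_of_pow_eq hb]
  exact D.r_mul_n₂

lemma orderOf_ζ₂_pow (i : ℕ) : orderOf (D.ζ₂ ^ i) = D.d₂ / Nat.gcd i D.d₂ :=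
  orderOf_pow_of_isPrimitiveRoot D.d₂_pos D.isPrimitiveRoot_ζ₂ i

lemma ζ₂_pow_Q_pow_eq_iff (i a c : ℕ) :
    D.ζ₂ ^ (i * D.Q ^ a) = D.ζ₂ ^ (i * D.Q ^ c) ↔ a ≡ c [MOD D.t i] := by
  have hfin : IsOfFinOrder (D.ζ₂ ^ i) := (D.isPrimitiveRoot_ζ₂.isOfFinOrder D.d₂_pos.ne').pow
  rw [pow_mul, pow_mul, pow_pow_eq_pow_pow_iff hfin, D.orderOf_ζ₂_pow, D.t_eq_orderOf]
  rw [D.orderOf_ζ₂_pow]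
  exact D.coprime_Q_d₂.coprime_dvd_right (D.d₂_div_gcd_dvd i)

lemma isOfFinOrder_const (j v i m : ℕ) : IsOfFinOrder (D.const j v i m) :=
  (D.isPrimitiveRoot_ζ₂.isOfFinOrder D.d₂_pos.ne').pow.mul
    (D.isOfFinOrder_of_pow_eq (D.base_pow_d₁ j)).pow

variable {v : ℕ}

lemma orderOf_base_pow (hv : v ∣ D.n₂) (j : ℕ) : orderOf (D.base j ^ (D.r * v)) = D.e * D.d₁ := by
  rw [Nat.Coprime.orderOf_pow, D.orderOf_of_pow_eq (D.base_pow_d₁ j)]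
  rw [D.orderOf_of_pow_eq (D.base_pow_d₁ j)]
  exact (D.coprime_r.mul_left (D.coprime_n₂.coprime_dvd_left hv)).symm

lemma orderOf_const (hv : v ∣ D.n₂) (j i m : ℕ) : orderOf (D.const j v i m) = D.ord i := by
  have hζ : orderOf (D.ζ₂ ^ (i * D.Q ^ m)) = D.d₂ / Nat.gcd i D.d₂ := by
    rw [orderOf_ζ₂_pow, Nat.Coprime.gcd_mul_right_cancel]
    exact D.coprime_Q_d₂.pow_left m
  have hco : (D.e * D.d₁).Coprime (D.d₂ / Nat.gcd i D.d₂) := D.coprime_d₂_div_gcd i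
  rw [const, (Commute.all _ _).orderOf_mul_eq_mul_orderOf_of_coprime, hζ, D.orderOf_base_pow hv,
    mul_comm, Setting.ord]
  rw [hζ, D.orderOf_base_pow hv]
  exact hco.symm

lemma natDegree_minpoly_const (hv : v ∣ D.n₂) (j i m : ℕ) :
    (minpoly F (D.const j v i m)).natDegree = D.k * Nat.lcm (D.t i) D.s₁ := by
  rw [natDegree_minpoly_eq_orderOf (D.isOfFinOrder_const j v i m), D.orderOf_const hv,
    D.orderOf_natCast_ord]

lemma const_pow_n₂_div (hv : v ∣ D.n₂ / D.d₂) (j i m : ℕ) :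
    D.const j v i m ^ (D.n₂ / v) = D.base j := by
  have hvn : v ∣ D.n₂ := D.dvd_n₂_of_dvd_div hv
  have hd : D.d₂ ∣ D.n₂ / v := by
    rwa [Nat.dvd_div_iff_mul_dvd hvn, mul_comm, ← Nat.dvd_div_iff_mul_dvd D.d₂_dvd]
  rw [const, mul_pow, pow_right_comm, (D.isPrimitiveRoot_ζ₂.pow_eq_one_iff_dvd _).2 hd, one_pow,
    one_mul, ← pow_mul, mul_assoc, Nat.mul_div_cancel' hvn, D.pow_r_mul_n₂ (D.base_pow_d₁ j)]

end Constants

section Factors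

variable [Finite F] {v i : ℕ}

lemma exponent_pos (hv : v ∣ D.n₂) : 0 < D.exponent v :=
  Nat.mul_pos (Nat.div_pos (Nat.le_of_dvd D.n₁_pos D.d₁_dvd) D.d₁_pos)
    (Nat.pos_of_dvd_of_pos hv D.n₂_pos)

lemma isOfFinOrder_of_pow_exponent_eq (hv : v ∣ D.n₂) {j m : ℕ} {γ : E}
    (hγ : γ ^ D.exponent v = D.const j v i m) : IsOfFinOrder γ :=
  IsOfFinOrder.of_pow (hγ ▸ D.isOfFinOrder_const j v i m) (D.exponent_pos hv).ne'

lemma minpoly_eq_factor (hv : v ∣ D.n₂ / D.d₂) (hi : i.Coprime v) {j m : ℕ} {γ : E}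
    (hγ : γ ^ D.exponent v = D.const j v i m) : minpoly F γ = D.factor j v i m := by
  have hvn : v ∣ D.n₂ := D.dvd_n₂_of_dvd_div hv
  have hord : orderOf (γ ^ D.exponent v) = D.ord i := by rw [hγ, D.orderOf_const hvn]
  have hQ : Nat.card F ^ (D.k * D.s) = D.Q ^ D.s := (D.Q_pow D.s).symm
  rw [factor, ← hγ]
  refine minpoly_eq_expand_of_not_dvd (D.isOfFinOrder_of_pow_exponent_eq hvn hγ)
    (D.exponent_pos hvn) (Nat.mul_pos D.k_pos D.s_pos) ?_ (fun p hp hpT => ⟨?_, ?_⟩) fun h4 => ?_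
  · rw [hord, hQ]
    exact D.ord_dvd_pow_sub_one i
  · rw [hord]
    exact D.prime_dvd_ord hv hi hp hpT
  · rw [hord, hQ]
    exact D.not_prime_mul_ord_dvd hv hi hp hpT
  · rw [hQ]
    exact D.four_dvd_pow_sub_one hv h4

lemma orderOf_of_pow_exponent_eq (hv : v ∣ D.n₂ / D.d₂) (hi : i.Coprime v) {j m : ℕ} {γ : E}
    (hγ : γ ^ D.exponent v = D.const j v i m) :
    orderOf γ = D.e * D.n₁ * v * (D.d₂ / Nat.gcd i D.d₂) := by
  have hvn : v ∣ D.n₂ := D.dvd_n₂_of_dvd_div hv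
  have hord : orderOf (γ ^ D.exponent v) = D.ord i := by rw [hγ, D.orderOf_const hvn]
  rw [orderOf_eq_mul_of_prime_dvd (D.exponent_pos hvn), hord, Setting.ord, exponent]
  · conv_rhs => rw [← Nat.mul_div_cancel' D.d₁_dvd]
    ring
  · rw [hord]
    exact fun p hp => D.prime_dvd_ord hv hi hp

lemma natDegree_factor (hv : v ∣ D.n₂) (j i m : ℕ) :
    (D.factor j v i m).natDegree = D.k * (D.n₁ / D.d₁) * v * Nat.lcm (D.t i) D.s₁ := by
  rw [factor, natDegree_expand, D.natDegree_minpoly_const hv, exponent]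
  ring

lemma monic_factor (hv : v ∣ D.n₂) (j i m : ℕ) : (D.factor j v i m).Monic :=
  (minpoly.monic (isIntegral_of_isOfFinOrder F (D.isOfFinOrder_const j v i m))).expand
    (D.exponent_pos hv)

lemma map_factor_eq_explicitPoly (hv : v ∣ D.n₂) (j i m : ℕ) :
    (D.factor j v i m).map (algebraMap F E) =
      explicitPoly (Nat.card F) (D.exponent v) (D.k * Nat.lcm (D.t i) D.s₁) (D.const j v i m) := by
  rw [factor, map_expand_minpoly_eq_prod (D.isOfFinOrder_const j v i m),
    D.natDegree_minpoly_const hv, prod_binomial_eq_explicitPoly]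

lemma map_factor_eq_spin (hv : v ∣ D.n₂) (j i m : ℕ) :
    (D.factor j v i m).map (algebraMap F E) =
      spin F (X ^ D.exponent v - C (D.const j v i m)) :=
  map_expand_minpoly_eq_spin (D.exponent_pos hv) (D.isOfFinOrder_const j v i m)

lemma coeffDeg_binomial_const (hv : v ∣ D.n₂) (j i m : ℕ) :
    coeffDeg F (X ^ D.exponent v - C (D.const j v i m)) = D.k * Nat.lcm (D.t i) D.s₁ := by
  rw [coeffDeg_binomial (D.exponent_pos hv)
    (isIntegral_of_isOfFinOrder F (D.isOfFinOrder_const j v i m)), D.natDegree_minpoly_const hv]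

variable [IsAlgClosed E]

lemma irreducible_factor (hv : v ∣ D.n₂ / D.d₂) (hi : i.Coprime v) (j m : ℕ) :
    Irreducible (D.factor j v i m) := by
  have hvn : v ∣ D.n₂ := D.dvd_n₂_of_dvd_div hv
  obtain ⟨γ, hγ⟩ := IsAlgClosed.exists_pow_nat_eq (D.const j v i m) (D.exponent_pos hvn)
  rw [← D.minpoly_eq_factor hv hi hγ]
  exact minpoly.irreducible
    (isIntegral_of_isOfFinOrder F (D.isOfFinOrder_of_pow_exponent_eq hvn hγ))

lemma polyOrder_factor (hv : v ∣ D.n₂ / D.d₂) (hi : i.Coprime v) (j m : ℕ) :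
    polyOrder (D.factor j v i m) = D.e * D.n₁ * v * (D.d₂ / Nat.gcd i D.d₂) := by
  obtain ⟨γ, hγ⟩ := IsAlgClosed.exists_pow_nat_eq (D.const j v i m)
    (D.exponent_pos (D.dvd_n₂_of_dvd_div hv))
  rw [← D.minpoly_eq_factor hv hi hγ, polyOrder_minpoly, D.orderOf_of_pow_exponent_eq hv hi hγ]

lemma factor_dvd_expand (hv : v ∣ D.n₂ / D.d₂) (hi : i.Coprime v) (j m : ℕ) :
    D.factor j v i m ∣ expand F (D.n₁ * D.n₂) (minpoly F D.α) := by
  have hvn : v ∣ D.n₂ := D.dvd_n₂_of_dvd_div hv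
  obtain ⟨γ, hγ⟩ := IsAlgClosed.exists_pow_nat_eq (D.const j v i m) (D.exponent_pos hvn)
  have hexp : D.n₁ * D.n₂ = D.exponent v * (D.n₂ / v) * D.d₁ := by
    conv_lhs => rw [← Nat.div_mul_cancel D.d₁_dvd, ← Nat.mul_div_cancel' hvn]
    rw [exponent]
    ring
  have hpow : γ ^ (D.n₁ * D.n₂) = D.α := by
    rw [hexp, pow_mul, pow_mul, hγ, D.const_pow_n₂_div hv, D.base_pow_d₁]
  rw [← D.minpoly_eq_factor hv hi hγ, minpoly.dvd_iff, expand_aeval, hpow, minpoly.aeval]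

end Factors

section Uniqueness

variable [Finite F] {J I : Finset ℕ} {j v i m j' v' i' m' : ℕ}

lemma exists_const_eq_of_factor_eq (hv : v ∣ D.n₂ / D.d₂)
    (h : D.factor j v i m = D.factor j' v i' m') :
    ∃ u, D.const j v i m = D.const j' v i' m' ^ D.Q ^ u := by
  have hα : IsIntegral F D.α := isIntegral_of_isOfFinOrder F D.isOfFinOrder_α
  obtain ⟨u, hu⟩ := exists_eq_pow_card_pow_of_minpoly_eq (D.isOfFinOrder_const j' v i' m')
    (expand_injective (D.exponent_pos (D.dvd_n₂_of_dvd_div hv)) h)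
  have hbase : D.base j = D.base j' ^ Nat.card F ^ u := by
    rw [← D.const_pow_n₂_div hv j i m, hu, pow_right_comm, D.const_pow_n₂_div hv]
  have hk : D.k ∣ u := by
    rw [Setting.k, ← pow_card_pow_eq_self_iff hα]
    conv_rhs => rw [← D.base_pow_d₁ j, hbase, pow_right_comm, D.base_pow_d₁]
  obtain ⟨u, rfl⟩ := hk
  exact ⟨u, by rw [D.Q_pow, hu]⟩

lemma base_eq_and_modEq_of_const_eq (hv : v ∣ D.n₂ / D.d₂) {u : ℕ}
    (h : D.const j v i m = D.const j' v i' m' ^ D.Q ^ u) :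
    D.base j = D.base j' ^ D.Q ^ u ∧ i * D.Q ^ m ≡ i' * D.Q ^ (m' + u) [MOD D.d₂] := by
  have hbase : D.base j = D.base j' ^ D.Q ^ u := by
    rw [← D.const_pow_n₂_div hv j i m, h, pow_right_comm, D.const_pow_n₂_div hv]
  refine ⟨hbase, (pow_eq_pow_iff_modEq_of_isPrimitiveRoot D.d₂_pos D.isPrimitiveRoot_ζ₂ _ _).1 ?_⟩
  rw [const_pow_Q_pow, ← hbase, const] at h
  exact mul_right_cancel₀ (pow_ne_zero _ (D.ne_zero_of_pow_eq (D.base_pow_d₁ j))) h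

lemma index_eq_of_const_eq (hJ : IsRepSystem D.d₁ (expRel D.Q D.s₁ D.ζ₁ D.β) J)
    (hI : IsCycloRepSystem D.Q D.d₂ I) (hv : v ∣ D.n₂ / D.d₂) (hj : j ∈ J) (hj' : j' ∈ J)
    (hi : i ∈ I) (hi' : i' ∈ I) (hm : m < Nat.gcd (D.t i) D.s₁)
    (hm' : m' < Nat.gcd (D.t i') D.s₁) {u : ℕ}
    (h : D.const j v i m = D.const j' v i' m' ^ D.Q ^ u) : j = j' ∧ i = i' ∧ m = m' := by
  obtain ⟨hbase, hmod⟩ := D.base_eq_and_modEq_of_const_eq hv h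
  obtain rfl : j = j' := hJ.eq_of_rel hj hj'
    ((D.expRel_iff_exists_base j j).2 ⟨0, by rw [pow_zero, pow_one]⟩)
    ((D.expRel_iff_exists_base j' j).2 ⟨u, hbase⟩)
  obtain rfl : i = i' := hI.eq_of_modEq D.d₂_pos hi hi' hmod
  refine ⟨rfl, rfl, Nat.ModEq.eq_of_lt_of_lt ?_ hm hm'⟩
  have hu : u ≡ 0 [MOD D.s₁] := by
    rw [← D.pow_Q_pow_eq_iff (D.base_pow_d₁ j), ← hbase, pow_zero, pow_one]
  have hmt : m ≡ m' + u [MOD D.t i] := by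
    rwa [← D.ζ₂_pow_Q_pow_eq_iff,
      pow_eq_pow_iff_modEq_of_isPrimitiveRoot D.d₂_pos D.isPrimitiveRoot_ζ₂]
  exact (hmt.of_dvd (Nat.gcd_dvd_left _ _)).trans
    ((hu.of_dvd (Nat.gcd_dvd_right _ _)).add_left m')

lemma index_eq_of_factor_eq [IsAlgClosed E]
    (hJ : IsRepSystem D.d₁ (expRel D.Q D.s₁ D.ζ₁ D.β) J) (hI : IsCycloRepSystem D.Q D.d₂ I)
    (hv : v ∣ D.n₂ / D.d₂) (hv' : v' ∣ D.n₂ / D.d₂) (hiv : i.Coprime v) (hiv' : i'.Coprime v')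
    (hj : j ∈ J) (hj' : j' ∈ J) (hi : i ∈ I) (hi' : i' ∈ I)
    (hm : m < Nat.gcd (D.t i) D.s₁) (hm' : m' < Nat.gcd (D.t i') D.s₁)
    (h : D.factor j v i m = D.factor j' v' i' m') : j = j' ∧ v = v' ∧ i = i' ∧ m = m' := by
  have hord : D.e * D.n₁ * (v * (D.d₂ / Nat.gcd i D.d₂)) =
      D.e * D.n₁ * (v' * (D.d₂ / Nat.gcd i' D.d₂)) := by
    rw [← mul_assoc, ← mul_assoc, ← D.polyOrder_factor hv hiv j m, h, D.polyOrder_factor hv' hiv']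
  obtain rfl : v = v' := eq_of_mul_div_gcd_eq D.d₂_pos hiv hiv'
    (Nat.eq_of_mul_eq_mul_left (Nat.mul_pos D.e_pos D.n₁_pos) hord)
  obtain ⟨u, hu⟩ := D.exists_const_eq_of_factor_eq hv h
  obtain ⟨hjj, hii, hmm⟩ := D.index_eq_of_const_eq hJ hI hv hj hj' hi hi' hm hm' hu
  exact ⟨hjj, rfl, hii, hmm⟩

end Uniqueness

section Existence

variable [Finite F] {J I : Finset ℕ}

lemma exists_pow_exponent_eq {γ : E} (hγ : γ ^ (D.n₁ * D.n₂) = D.α) :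
    ∃ b, b ^ D.d₁ = D.α ∧ ∃ v i, v ∣ D.n₂ / D.d₂ ∧ i.Coprime v ∧
      γ ^ D.exponent v = D.ζ₂ ^ i * b ^ (D.r * v) := by
  set y : E := γ ^ (D.n₁ / D.d₁) with hy
  have hb : (y ^ D.n₂) ^ D.d₁ = D.α := by
    rw [hy, ← pow_mul, ← pow_mul, mul_comm D.n₂, ← mul_assoc, Nat.div_mul_cancel D.d₁_dvd, hγ]
  have hb0 : y ^ D.n₂ ≠ 0 := D.ne_zero_of_pow_eq hb
  have hw : (y / (y ^ D.n₂) ^ D.r) ^ D.n₂ = 1 := by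
    rw [div_pow, ← pow_mul (y ^ D.n₂), D.pow_r_mul_n₂ hb, div_self hb0]
  obtain ⟨v, i, hlcm, hiv, hwv⟩ := exists_coprime_pow_eq_pow D.d₂_pos D.isPrimitiveRoot_ζ₂
    (isOfFinOrder_iff_pow_eq_one.2 ⟨_, D.n₂_pos, hw⟩)
    fun p hp hpw => D.prime_dvd_d₂ hp (hpw.trans (orderOf_dvd_of_pow_eq_one hw))
  refine ⟨y ^ D.n₂, hb, v, i, ?_, hiv, ?_⟩
  · rw [Nat.dvd_div_iff_mul_dvd D.d₂_dvd, hlcm]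
    exact Nat.lcm_dvd (orderOf_dvd_of_pow_eq_one hw) D.d₂_dvd
  · rw [← hwv, div_pow, ← pow_mul (y ^ D.n₂), div_mul_cancel₀ _ (pow_ne_zero _ hb0), exponent,
      pow_mul γ]

lemma exists_const_pow_eq (hJ : IsRepSystem D.d₁ (expRel D.Q D.s₁ D.ζ₁ D.β) J)
    (hI : IsCycloRepSystem D.Q D.d₂ I) {b : E} (hb : b ^ D.d₁ = D.α) {v a : ℕ}
    (hv : v ∣ D.n₂) (hav : a.Coprime v) :
    ∃ j ∈ J, ∃ i ∈ I, i.Coprime v ∧ ∃ m < Nat.gcd (D.t i) D.s₁, ∃ u,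
      D.ζ₂ ^ a * b ^ (D.r * v) = D.const j v i m ^ D.Q ^ u := by
  obtain ⟨j', hj', rfl⟩ := D.exists_base_eq hb
  obtain ⟨j, ⟨hj, hrel⟩, -⟩ := hJ.2 j' hj'
  obtain ⟨c, hc⟩ := (D.expRel_iff_exists_base j j').1 hrel
  obtain ⟨i, hi, l, hl⟩ := hI.exists_modEq D.d₂_pos a
  have hiv : i.Coprime v := coprime_of_modEq_mul (fun p hp h => D.prime_dvd_d₂ hp (h.trans hv))
    hl hav
  obtain ⟨m, hm, u, hus, hut⟩ := exists_lt_gcd_add_modEq (s := D.s₁) (D.t_pos i) l c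
  refine ⟨j, hj, i, hi, hiv, m, hm, u, ?_⟩
  rw [const_pow_Q_pow, (D.ζ₂_pow_Q_pow_eq_iff i _ _).2 hut,
    (D.pow_Q_pow_eq_iff (D.base_pow_d₁ j) _ _).2 hus, ← hc,
    (pow_eq_pow_iff_modEq_of_isPrimitiveRoot D.d₂_pos D.isPrimitiveRoot_ζ₂ _ _).2 hl]

lemma exists_aeval_factor_eq_zero (hJ : IsRepSystem D.d₁ (expRel D.Q D.s₁ D.ζ₁ D.β) J)
    (hI : IsCycloRepSystem D.Q D.d₂ I) {γ : E}
    (hγ : aeval γ (expand F (D.n₁ * D.n₂) (minpoly F D.α)) = 0) :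
    ∃ j ∈ J, ∃ v, v ∣ D.n₂ / D.d₂ ∧ ∃ i ∈ I, i.Coprime v ∧ ∃ m < Nat.gcd (D.t i) D.s₁,
      aeval γ (D.factor j v i m) = 0 := by
  have hα : IsIntegral F D.α := isIntegral_of_isOfFinOrder F D.isOfFinOrder_α
  rw [expand_aeval] at hγ
  have hmin : minpoly F (γ ^ (D.n₁ * D.n₂)) = minpoly F D.α :=
    (minpoly.eq_of_irreducible_of_monic (minpoly.irreducible hα) hγ (minpoly.monic hα)).symm
  have hfin : IsOfFinOrder (γ ^ (D.n₁ * D.n₂)) := by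
    obtain ⟨c, hc⟩ := exists_eq_pow_card_pow_of_minpoly_eq D.isOfFinOrder_α hmin
    exact hc ▸ D.isOfFinOrder_α.pow
  obtain ⟨c, hc⟩ := exists_eq_pow_card_pow_of_minpoly_eq hfin hmin.symm
  rw [pow_right_comm] at hc
  obtain ⟨b, hb, v, a, hv, hav, hγv⟩ := D.exists_pow_exponent_eq hc.symm
  obtain ⟨j, hj, i, hi, hiv, m, hm, u, hu⟩ :=
    D.exists_const_pow_eq hJ hI hb (D.dvd_n₂_of_dvd_div hv) hav
  refine ⟨j, hj, v, hv, i, hi, hiv, m, hm, ?_⟩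
  have hq : ∀ l, Nat.card F ^ l ≠ 0 := fun l => (Nat.pow_pos Nat.card_pos).ne'
  rw [← pow_eq_zero_iff (hq c), ← aeval_pow_card_pow, factor, expand_aeval, hγv, hu, D.Q_pow,
    aeval_pow_card_pow, minpoly.aeval, zero_pow (hq _)]

lemma separable_expand_minpoly : (expand F (D.n₁ * D.n₂) (minpoly F D.α)).Separable := by
  have hco : (D.n₁ * D.n₂ * D.e).Coprime (Nat.card F) :=
    D.coprime_card.mul_left (coprime_card_orderOf F D.isOfFinOrder_α).symm
  have hdvd : expand F (D.n₁ * D.n₂) (minpoly F D.α) ∣ X ^ (D.n₁ * D.n₂ * D.e) - 1 := by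
    have hmin : minpoly F D.α ∣ X ^ D.e - 1 := by
      rw [minpoly.dvd_iff]
      simp [Setting.e, pow_orderOf_eq_one]
    have := _root_.map_dvd (expand F (D.n₁ * D.n₂)) hmin
    rwa [map_sub, map_pow, expand_X, ← pow_mul, map_one] at this
  exact (X_pow_sub_one_separable_iff.2 (isUnit_natCast_of_coprime_card hco).ne_zero).of_dvd hdvd

theorem expand_minpoly_eq_prod_factor [IsAlgClosed E]
    (hJ : IsRepSystem D.d₁ (expRel D.Q D.s₁ D.ζ₁ D.β) J) (hI : IsCycloRepSystem D.Q D.d₂ I) :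
    expand F (D.n₁ * D.n₂) (minpoly F D.α) =
      ∏ j ∈ J, ∏ v ∈ (D.n₂ / D.d₂).divisors, ∏ i ∈ I with Nat.gcd i v = 1,
        ∏ m ∈ Finset.range (Nat.gcd (D.t i) D.s₁), D.factor j v i m := by
  have hα : IsIntegral F D.α := isIntegral_of_isOfFinOrder F D.isOfFinOrder_α
  have hdiv : D.n₂ / D.d₂ ≠ 0 := (Nat.div_pos (Nat.le_of_dvd D.n₂_pos D.d₂_dvd) D.d₂_pos).ne'
  let index : Finset (Σ _ : ℕ, Σ _ : ℕ, Σ _ : ℕ, ℕ) :=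
    J.sigma fun _ => (D.n₂ / D.d₂).divisors.sigma fun v =>
      {i ∈ I | Nat.gcd i v = 1}.sigma fun i => Finset.range (Nat.gcd (D.t i) D.s₁)
  have hmem : ∀ a, a ∈ index ↔ a.1 ∈ J ∧ a.2.1 ∣ D.n₂ / D.d₂ ∧ (a.2.2.1 ∈ I ∧
      a.2.2.1.Coprime a.2.1) ∧ a.2.2.2 < Nat.gcd (D.t a.2.2.1) D.s₁ := by
    simp [index, Nat.Coprime, hdiv]
  rw [eq_prod_of_separable (E := E) (s := index)
    (P := fun a => D.factor a.1 a.2.1 a.2.2.1 a.2.2.2)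
    ((minpoly.monic hα).expand D.n₁_mul_n₂_pos) D.separable_expand_minpoly]
  · simp only [index, Finset.prod_sigma]
  all_goals simp only [Set.InjOn, Finset.mem_coe, hmem]
  · rintro ⟨j, v, i, m⟩ ⟨-, hv, -, -⟩
    exact D.monic_factor (D.dvd_n₂_of_dvd_div hv) j i m
  · rintro ⟨j, v, i, m⟩ ⟨-, hv, ⟨-, hiv⟩, -⟩
    exact D.irreducible_factor hv hiv j m
  · rintro ⟨j, v, i, m⟩ ⟨-, hv, ⟨-, hiv⟩, -⟩
    exact D.factor_dvd_expand hv hiv j m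
  · rintro ⟨j, v, i, m⟩ ⟨hj, hv, ⟨hi, hiv⟩, hm⟩ ⟨j', v', i', m'⟩ ⟨hj', hv', ⟨hi', hiv'⟩, hm'⟩ h
    obtain ⟨rfl, rfl, rfl, rfl⟩ :=
      D.index_eq_of_factor_eq hJ hI hv hv' hiv hiv' hj hj' hi hi' hm hm' h
    rfl
  · intro γ hγ
    obtain ⟨j, hj, v, hv, i, hi, hiv, m, hm, h⟩ := D.exists_aeval_factor_eq_zero hJ hI hγ
    exact ⟨⟨j, v, i, m⟩, ⟨hj, hv, ⟨hi, hiv⟩, hm⟩, h⟩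

end Existence

end RootData

end PowerComp

open Polynomial in
theorem theorem27_general {F E : Type*} [Field F] [Finite F] [Field E] [Algebra F E]
    [IsAlgClosed E]
    (q : ℕ) (hq : q = Nat.card F)
    (f : F[X]) (hf_monic : f.Monic) (hf_irr : Irreducible f) (hf_X : f ≠ X)
    (k : ℕ) (hk : k = f.natDegree)
    (α : E) (hα : aeval α f = 0)
    (n n₁ n₂ : ℕ) (hnq : Nat.Coprime n q) (hn12 : n = n₁ * n₂)
    (hn₁ : UniqueFactorizationMonoid.radical n₁ ∣ orderOf α)
    (hn₂ : Nat.Coprime n₂ (orderOf α))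
    (s : ℕ) (hs0 : 0 < s) (hs : PowerComp.extDeg (q ^ k) n ∣ s)
    (d₁ : ℕ) (hd₁ : d₁ = PowerComp.dOne (q ^ k) (orderOf α) n₁ s)
    (d₂ : ℕ) (hd₂ : d₂ = PowerComp.dTwo (q ^ k) n₂ s)
    (s₁ : ℕ) (hs₁ : s₁ = PowerComp.sOne (q ^ k) (orderOf α) n₁ s)
    (t : ℕ → ℕ) (ht : ∀ i, t i = PowerComp.tNum (q ^ k) n₂ s i)
    (c : ℕ → ℕ) (hc : ∀ i, c i = PowerComp.cNum (q ^ k) (orderOf α) n₁ n₂ s i)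
    (ζ₁ ζ₂ : E) (hζ₁ : IsPrimitiveRoot ζ₁ d₁) (hζ₂ : IsPrimitiveRoot ζ₂ d₂) :
    (∃ β : E, β ^ q ^ (k * s) = β ∧ β ^ d₁ = α) ∧
    (∃ r : ℕ, 0 < r ∧
      ((f = X - 1 ∧ r = 1) ∨ (f ≠ X - 1 ∧ r * n₂ ≡ 1 [MOD orderOf α * d₁]))) ∧
    ∀ β : E, β ^ d₁ = α →
      Equivalence (fun j j' : Fin d₁ => PowerComp.expRel (q ^ k) s₁ ζ₁ β j j') ∧
      ∀ r : ℕ, ((f = X - 1 ∧ r = 1) ∨ (f ≠ X - 1 ∧ r * n₂ ≡ 1 [MOD orderOf α * d₁])) →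
      ∀ J : Finset ℕ, PowerComp.IsRepSystem d₁ (PowerComp.expRel (q ^ k) s₁ ζ₁ β) J →
      ∀ I : Finset ℕ, PowerComp.IsCycloRepSystem (q ^ k) d₂ I →
      ∃ S : ℕ → ℕ → ℕ → ℕ → F[X],
        f.comp (X ^ n) =
          ∏ j ∈ J, ∏ v ∈ (n₂ / d₂).divisors, ∏ i ∈ I with Nat.gcd i v = 1,
            ∏ m ∈ Finset.range (Nat.gcd (t i) s₁), S j v i m ∧
        ∀ j ∈ J, ∀ v ∈ (n₂ / d₂).divisors, ∀ i ∈ I, Nat.gcd i v = 1 →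
          ∀ m < Nat.gcd (t i) s₁,
            (S j v i m).map (algebraMap F E) =
              PowerComp.explicitPoly q (n₁ / d₁ * v) (k * c i)
                (ζ₂ ^ (i * (q ^ k) ^ m) * (ζ₁ ^ j * β) ^ (r * v)) ∧
            (S j v i m).Monic ∧
            Irreducible (S j v i m) ∧
            (S j v i m).natDegree = k * (n₁ / d₁) * v * c i ∧
            PowerComp.polyOrder (S j v i m) =
              orderOf α * n₁ * v * (d₂ / Nat.gcd i d₂) ∧
            PowerComp.coeffDeg F (X ^ (n₁ / d₁ * v) -
              C (ζ₂ ^ (i * (q ^ k) ^ m) * (ζ₁ ^ j * β) ^ (r * v))) = k * c i ∧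
            (S j v i m).map (algebraMap F E) =
              PowerComp.spin F (X ^ (n₁ / d₁ * v) -
                C (ζ₂ ^ (i * (q ^ k) ^ m) * (ζ₁ ^ j * β) ^ (r * v))) := by
  subst hq hk hn12 hd₁ hd₂ hs₁
  obtain rfl : t = _ := funext ht
  obtain rfl : c = _ := funext hc
  obtain rfl : f = minpoly F α := minpoly.eq_of_irreducible_of_monic hf_irr hα hf_monic
  have hα0 : α ≠ 0 := fun h => hf_X (by rw [h, minpoly.zero])
  let D : PowerComp.Setting F E :=
    { α, n₁, n₂, s
      isOfFinOrder_α := PowerComp.isOfFinOrder_of_isIntegral ⟨_, hf_monic, hα⟩ hα0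
      coprime_card := hnq
      radical_dvd := hn₁
      coprime_orderOf := hn₂
      s_pos := hs0
      extDeg_dvd := hs }
  obtain ⟨β₀, hβ₀⟩ := IsAlgClosed.exists_pow_nat_eq α D.d₁_pos
  refine ⟨⟨β₀, D.pow_card_pow_mul_eq hβ₀, hβ₀⟩, D.exists_exponent, fun β hβ =>
    ⟨(D.equivalence_expRel hζ₁.pow_eq_one hβ).comap Fin.val, fun r hr J hJ I hI => ?_⟩⟩
  let R : PowerComp.RootData F E := ⟨D, ζ₁, ζ₂, β, r, hζ₁, hζ₂, hβ, D.mul_n₂_modEq_one hr⟩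
  refine ⟨R.factor, expand_eq_comp_X_pow (R := F) _ ▸ R.expand_minpoly_eq_prod_factor hJ hI,
    fun j _ v hv i _ hiv m _ => ?_⟩
  have hvd : v ∣ n₂ / R.d₂ := Nat.dvd_of_mem_divisors hv
  have hvn : v ∣ n₂ := R.dvd_n₂_of_dvd_div hvd
  exact ⟨R.map_factor_eq_explicitPoly hvn j i m, R.monic_factor hvn j i m,
    R.irreducible_factor hvd hiv j m, R.natDegree_factor hvn j i m,
    R.polyOrder_factor hvd hiv j m, R.coeffDeg_binomial_const hvn j i m,
    R.map_factor_eq_spin hvn j i m⟩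

open Polynomial in
theorem theorem27 {F E : Type*} [Field F] [Finite F] [Field E] [Algebra F E]
    [IsAlgClosure F E]
    (q : ℕ) (hq : q = Nat.card F)
    (f : F[X]) (hf_monic : f.Monic) (hf_irr : Irreducible f) (hf_X : f ≠ X)
    (k : ℕ) (hk : k = f.natDegree)
    (α : E) (hα : aeval α f = 0)
    (n n₁ n₂ : ℕ) (hn : 0 < n) (hnq : Nat.Coprime n q) (hn12 : n = n₁ * n₂)
    (hn₁ : UniqueFactorizationMonoid.radical n₁ ∣ orderOf α)
    (hn₂ : Nat.Coprime n₂ (orderOf α))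
    (s : ℕ) (hs : s = PowerComp.extDeg (q ^ k) n)
    (d₁ : ℕ) (hd₁ : d₁ = PowerComp.dOne (q ^ k) (orderOf α) n₁ s)
    (d₂ : ℕ) (hd₂ : d₂ = PowerComp.dTwo (q ^ k) n₂ s)
    (s₁ : ℕ) (hs₁ : s₁ = PowerComp.sOne (q ^ k) (orderOf α) n₁ s)
    (t : ℕ → ℕ) (ht : ∀ i, t i = PowerComp.tNum (q ^ k) n₂ s i)
    (c : ℕ → ℕ) (hc : ∀ i, c i = PowerComp.cNum (q ^ k) (orderOf α) n₁ n₂ s i)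
    (ζ₁ ζ₂ : E) (hζ₁ : IsPrimitiveRoot ζ₁ d₁) (hζ₂ : IsPrimitiveRoot ζ₂ d₂) :
    -- `β` exists in the subfield with `q ^ (k * s)` elements
    (∃ β : E, β ^ q ^ (k * s) = β ∧ β ^ d₁ = α) ∧
    -- an exponent `r` exists
    (∃ r : ℕ, 0 < r ∧
      ((f = X - 1 ∧ r = 1) ∨ (f ≠ X - 1 ∧ r * n₂ ≡ 1 [MOD orderOf α * d₁]))) ∧
    -- the factorization, for every choice of `β`, `r` and the representatives
    ∀ β : E, β ^ q ^ (k * s) = β → β ^ d₁ = α →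
      Equivalence (fun j j' : Fin d₁ => PowerComp.expRel (q ^ k) s₁ ζ₁ β j j') ∧
      ∀ r : ℕ, 0 < r →
        ((f = X - 1 ∧ r = 1) ∨ (f ≠ X - 1 ∧ r * n₂ ≡ 1 [MOD orderOf α * d₁])) →
      ∀ J : Finset ℕ, PowerComp.IsRepSystem d₁ (PowerComp.expRel (q ^ k) s₁ ζ₁ β) J →
      ∀ I : Finset ℕ, PowerComp.IsCycloRepSystem (q ^ k) d₂ I →
      ∃ S : ℕ → ℕ → ℕ → ℕ → F[X],
        f.comp (X ^ n) =
          ∏ j ∈ J, ∏ v ∈ (n₂ / d₂).divisors, ∏ i ∈ I with Nat.gcd i v = 1,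
            ∏ m ∈ Finset.range (Nat.gcd (t i) s₁), S j v i m ∧
        ∀ j ∈ J, ∀ v ∈ (n₂ / d₂).divisors, ∀ i ∈ I, Nat.gcd i v = 1 →
          ∀ m < Nat.gcd (t i) s₁,
            (S j v i m).map (algebraMap F E) =
              PowerComp.explicitPoly q (n₁ / d₁ * v) (k * c i)
                (ζ₂ ^ (i * (q ^ k) ^ m) * (ζ₁ ^ j * β) ^ (r * v)) ∧
            (S j v i m).Monic ∧
            Irreducible (S j v i m) ∧
            (S j v i m).natDegree = k * (n₁ / d₁) * v * c i ∧
            PowerComp.polyOrder (S j v i m) =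
              orderOf α * n₁ * v * (d₂ / Nat.gcd i d₂) ∧
            -- `S j v i m` is the `q`-spin of a binomial
            PowerComp.coeffDeg F (X ^ (n₁ / d₁ * v) -
              C (ζ₂ ^ (i * (q ^ k) ^ m) * (ζ₁ ^ j * β) ^ (r * v))) = k * c i ∧
            (S j v i m).map (algebraMap F E) =
              PowerComp.spin F (X ^ (n₁ / d₁ * v) -
                C (ζ₂ ^ (i * (q ^ k) ^ m) * (ζ₁ ^ j * β) ^ (r * v))) := by
  have : IsAlgClosed E := IsAlgClosure.isAlgClosed F
  obtain ⟨hβ, hr, h⟩ := theorem27_general q hq f hf_monic hf_irr hf_X k hk α hα n n₁ n₂ hnq hn12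
    hn₁ hn₂ s (hs ▸ PowerComp.extDeg_pos (hnq.pow_right k)) hs.symm.dvd d₁ hd₁ d₂ hd₂ s₁ hs₁ t ht
    c hc ζ₁ ζ₂ hζ₁ hζ₂
  exact ⟨hβ, hr, fun β _ hβ => ⟨(h β hβ).1, fun r _ => (h β hβ).2 r⟩⟩
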